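/- Let $k$ be a field of characteristic $0$, let $M\ge 1$, and let $\zeta\in k$ be a primitive $M$-th root of unity (such a $\zeta$ exists for every $M$ if, for instance, $k$ is algebraically closed). Let $V$ be a vertex algebra over $k$, with $n$-th products $u_nv$ ($n\in\mathbb Z$) and vacuum $\mathbf 1$, and let $g,h$ be automorphisms of $V$ with $g^M=h^M=\mathrm{id}$. For $r\in\mathbb Z$ put $V^{g,r}=\{v\in V : gv=\zeta^{-r}v\}$, which depends only on $r$ modulo $M$. *Twisted loop algebras.* The space $V\otimes_k k[t^{\pm 1/M}]$ is a vertex algebra with vacuum $\mathbf 1\otimes 1$ and products $$(u\otimes s)_n(v\otimes s')=\sum_{j\ge 0}u_{n+j}v\otimes \tfrac{1}{j!}\Big(\tfrac{d}{dt}\Big)^{j}(s)\,s'.$$ Let $L(V,g)=\bigoplus_{0\le r<M}V^{g,r}\otimes t^{r/M}k[t^{\pm1}]$ be the vertex subalgebra of fixed points of $g\otimes\gamma$, where $\gamma$ is the $k$-algebra automorphism $t^{1/M}\mapsto\zeta t^{1/M}$. It is a vertex algebra over the differential ring $(k[t^{\pm1}],\frac{d}{dt})$ through the structure map $p\mapsto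 \mathbf 1\otimes p$. For $v\in V^{g,r}$ and $n\in\frac rM+\mathbb Z$ write $v_{(n)}=v\otimes t^n\in L(V,g)$. Define $L(V,h)$ in the same way. A $k[t^{\pm1}]$-vertex algebra map $L(V,g)\to L(V,h)$ is an additive map that preserves all $n$-th products and the vacuum and commutes with the structure maps from $k[t^{\pm1}]$. *Twisted modules.* A weak $g$-twisted $V$-module is a $k$-vector space $W$ with a $k$-linear map $v\mapsto Y_W(v,z)=\sum_{n\in\frac1M\mathbb Z}v_nz^{-n-1}$, $v_n\in\operatorname{End}_k(W)$, such that: $v_n=0$ if $v\in V^{g,r}$ and $n\notin\frac rM+\mathbb Z$; for all $v\in V$ and $w\in W$, $v_nw=0$ for $n\gg0$; $Y_W(\mathbf 1,z)=\mathrm{id}_W$; and for all $0\le r<M$, $u\in V^{g,r}$, $v\in V$ the twisted Jacobi identity $$z_0^{-1}\delta\Big(\frac{z_1-z_2}{z_0}\Big)Y_W(u,z_1)Y_W(v,z_2)-z_0^{-1}\delta\Big(\frac{z_2-z_1}{-z_0}\Big)Y_W(v,z_2)Y_W(u,z_1)=z_2^{-1}\Big(\frac{z_1-z_0}{z_2}\Big)^{-r/M}\delta\Big(\frac{z_1-z_0}{z_2}\Big)Y_W(Y(u,z_0)v,z_2)$$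 holds. **Proposition.** Let $\varphi\colon L(V,g)\to L(V,h)$ be a $k[t^{\pm1}]$-vertex algebra map, and let $W$ be a weak $h$-twisted $V$-module with vertex operator map $Y_W(v,z)=\sum_{n\in\frac1M\mathbb Z}v_nz^{-n-1}$. Let $\overline\varphi\colon L(V,g)\to\operatorname{End}_k(W)$ be the composite of $\varphi$ with the linear map $L(V,h)\to\operatorname{End}_k(W)$, $v_{(n)}\mapsto v_n$. Then there is exactly one linear map $\varphi^*Y_W\colon V\to\operatorname{End}_k(W)[[z^{1/M},z^{-1/M}]]$ with $$(\varphi^*Y_W)(v,z)=\sum_{n\in\frac rM+\mathbb Z}\overline\varphi(v_{(n)})\,z^{-n-1}\qquad(r\in\mathbb Z,\ v\in V^{g,r}),$$ and it makes $W$ into a weak $g$-twisted $V$-module. -/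

import Mathlib

open scoped TensorProduct

/-- A vertex algebra over a commutative ring `k` (without differential structure on `k`): a
`k`-module with `k`-bilinear `n`-th products `u_n v` and a vacuum vector, satisfying regularity,
creation, and the Jacobi identity, the latter written out in coefficients of the formal variables.
The sums over `i` have only finitely many nonzero terms by regularity. For `k = ℤ` this is a vertex
ring. -/
class VertexAlgebra (k V : Type*) [CommRing k] [AddCommGroup V] [Module k V] where
  /-- `nprod n u v` is `u_n v`, the coefficient of `z ^ (-n - 1)` in `Y(u, z) v`. -/
  nprod : ℤ → V →ₗ[k] V →ₗ[k] V
  vac : V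
  regular : ∀ u v : V, ∃ N : ℤ, ∀ n : ℤ, N ≤ n → nprod n u v = 0
  creation_nonneg : ∀ (v : V) (n : ℤ), 0 ≤ n → nprod n v vac = 0
  creation_neg_one : ∀ v : V, nprod (-1) v vac = v
  jacobi : ∀ (u v w : V) (l m n : ℤ),
    ∑ᶠ i : ℕ, Ring.choose m i • nprod (m + n - i) (nprod (l + i) u v) w =
    ∑ᶠ i : ℕ, ((-1) ^ i * Ring.choose l i) •
      (nprod (m + l - i) u (nprod (n + i) v w) -
        (l.negOnePow : ℤ) • nprod (n + l - i) v (nprod (m + i) u w))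

/-- An iterative Hasse-Schmidt derivation on a commutative `k`-algebra `S`, i.e. the structure of a
commutative vertex ring over `k`; `k` consists of constants. -/
class HasseSchmidt (k S : Type*) [CommRing k] [CommRing S] [Algebra k S] where
  D : ℕ → S →ₗ[k] S
  D_zero : ∀ s : S, D 0 s = s
  D_mul : ∀ (n : ℕ) (s t : S),
    D n (s * t) = ∑ p ∈ Finset.HasAntidiagonal.antidiagonal n, D p.1 s * D p.2 t
  D_comp : ∀ (i j : ℕ) (s : S), D i (D j s) = (i + j).choose i • D (i + j) s

namespace HasseSchmidt

variable (k : Type*) {S : Type*} [CommRing k] [CommRing S] [Algebra k S] [HasseSchmidt k S]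

/-- The `n`-th product of the commutative vertex ring attached to a Hasse-Schmidt derivation:
`Y(r, z) s = ∑_{j ≥ 0} D_j(r) s z ^ j`, so `r_n s = D_{-n-1}(r) s` for `n < 0`, and `0` else. -/
def nprod (n : ℤ) (r s : S) : S := if n < 0 then D (k := k) (-n - 1).toNat r * s else 0

end HasseSchmidt

namespace VertexAlgebra

section Basic

variable {k V : Type*} [CommRing k] [AddCommGroup V] [Module k V] [VertexAlgebra k V]

lemma finsum_eq_range {A : Type*} [AddCommMonoid A] (f : ℕ → A) (K : ℕ)
    (h : ∀ i, K ≤ i → f i = 0) : ∑ᶠ i, f i = ∑ i ∈ Finset.range K, f i := by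
  apply finsum_eq_sum_of_support_subset
  intro i hi
  simp only [Finset.coe_range, Set.mem_Iio]
  by_contra hc
  exact hi (h i (not_lt.mp hc))

variable (k) in
lemma exists_bound (u v : V) : ∃ N : ℕ, ∀ n : ℤ, (N : ℤ) ≤ n → nprod (k := k) n u v = 0 := by
  obtain ⟨N, hN⟩ := regular (k := k) u v
  exact ⟨N.toNat, fun n hn => hN n ((Int.self_le_toNat N).trans hn)⟩

/-- The Jacobi identity with explicitly truncated sums. -/
lemma jacobi_range (u v w : V) (l m n : ℤ) (K : ℕ)
    (h1 : ∀ i : ℕ, K ≤ i → nprod (k := k) (l + i) u v = 0)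
    (h2 : ∀ i : ℕ, K ≤ i → nprod (k := k) (n + i) v w = 0)
    (h3 : ∀ i : ℕ, K ≤ i → nprod (k := k) (m + i) u w = 0) :
    ∑ i ∈ Finset.range K, Ring.choose m i • nprod (k := k) (m + n - i) (nprod (k := k) (l + i) u v) w =
    ∑ i ∈ Finset.range K, ((-1) ^ i * Ring.choose l i) •
      (nprod (k := k) (m + l - i) u (nprod (k := k) (n + i) v w) -
        (l.negOnePow : ℤ) • nprod (k := k) (n + l - i) v (nprod (k := k) (m + i) u w)) := by
  have := jacobi (k := k) u v w l m n
  rwa [finsum_eq_range _ K, finsum_eq_range _ K] at this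
  · intro i hi; simp [h2 i hi, h3 i hi]
  · intro i hi; simp [h1 i hi]

/-- Skew symmetry, in a form with a truncated sum. -/
lemma skew (u v : V) (l : ℤ) (K : ℕ) (h1 : ∀ i : ℕ, K ≤ i → nprod (k := k) (l + i) u v = 0) :
    nprod (k := k) l v u = -((l.negOnePow : ℤ) • ∑ i ∈ Finset.range K,
      (-1 : ℤ) ^ i • nprod (k := k) (-1 - i) (nprod (k := k) (l + i) u v) (vac (k := k))) := by
  have h := jacobi (k := k) u v (vac (k := k) : V) l (-1) 0
  rw [finsum_eq_range _ K, finsum_eq_range _ 1] at h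
  · have e : ∀ i : ℕ, Ring.choose (-1 : ℤ) i = (-1) ^ i := by
      intro i
      have := Ring.choose_neg (1 : ℤ) i
      rw [this, show (1 : ℤ) + i - 1 = ((i : ℕ) : ℤ) by ring, Ring.choose_natCast]
      simp [Int.negOnePow_def, Units.smul_def]
    simp only [e] at h
    have h4 : nprod (k := k) 0 v (vac (k := k) : V) = 0 := creation_nonneg v 0 le_rfl
    simp only [add_zero, Finset.range_one, Finset.sum_singleton, pow_zero, one_mul, Nat.cast_zero,
      zero_add, sub_zero, Ring.choose_zero_right, one_smul, h4, map_zero, zero_sub,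
      creation_neg_one] at h
    rw [h, smul_neg, neg_neg, smul_smul]
    rcases Int.even_or_odd l with hl | hl
    · simp [Int.negOnePow_even l hl]
    · simp [Int.negOnePow_odd l hl]
  · intro i hi
    have h4 : nprod (k := k) (0 + i) v (vac (k := k) : V) = 0 := creation_nonneg v _ (by positivity)
    have h5 : nprod (k := k) (-1 + i) u (vac (k := k) : V) = 0 := creation_nonneg u _ (by omega)
    rw [h4, h5]; simp
  · intro i hi; simp [h1 i hi]

variable (k) in
/-- The canonical Hasse-Schmidt derivation `D_m v = v_{-m-1} 1`. -/
def canD (m : ℕ) (v : V) : V := nprod (k := k) (-1 - m) v (vac (k := k))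

lemma canD_vac (m : ℕ) (hm : 0 < m) : canD k m (vac (k := k) : V) = 0 := by
  induction m using Nat.strong_induction_on with
  | _ m ih =>
    have h := skew (k := k) (vac (k := k) : V) (vac (k := k)) (-1 - m) (m + 1)
      (fun i hi => creation_nonneg _ _ (by omega))
    obtain ⟨p, rfl⟩ : ∃ p, m = p + 1 := ⟨m - 1, by omega⟩
    rw [Finset.sum_range_succ, Finset.sum_range_succ'] at h
    have h0 : ∑ i ∈ Finset.range p, (-1 : ℤ) ^ (i + 1) • nprod (k := k) (-1 - ((i + 1 : ℕ) : ℤ))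
        (nprod (k := k) (-1 - ((p + 1 : ℕ) : ℤ) + ((i + 1 : ℕ) : ℤ)) (vac (k := k) : V) (vac (k := k))) (vac (k := k))
          = 0 := by
      apply Finset.sum_eq_zero
      intro i hi
      rw [Finset.mem_range] at hi
      have := ih (p - i) (by omega) (by omega)
      unfold canD at this
      rw [show -1 - ((p + 1 : ℕ) : ℤ) + ((i + 1 : ℕ) : ℤ) = -1 - ((p - i : ℕ) : ℤ) by omega, this]
      simp
    rw [h0] at h
    have h1 : -1 - ((p + 1 : ℕ) : ℤ) + ((p + 1 : ℕ) : ℤ) = -1 := by omega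
    rw [h1, creation_neg_one] at h
    change nprod (k := k) (-1 - ((p + 1 : ℕ) : ℤ)) (vac (k := k) : V) (vac (k := k)) = 0
    simp only [Nat.cast_zero, sub_zero, add_zero, creation_neg_one, pow_zero, one_smul,
      zero_add] at h
    set x := nprod (k := k) (-1 - ((p + 1 : ℕ) : ℤ)) (vac (k := k) : V) (vac (k := k))
    rcases Nat.even_or_odd p with hp | hp
    · have e1 : ((-1 : ℤ)) ^ (p + 1) = -1 := (Even.add_one hp).neg_one_pow
      rw [e1] at h
      simpa using h
    · have e1 : ((-1 : ℤ)) ^ (p + 1) = 1 := (Odd.add_one hp).neg_one_pow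
      have e2 : (-1 - ((p + 1 : ℕ) : ℤ)).negOnePow = -1 := by
        apply Int.negOnePow_odd
        obtain ⟨q, rfl⟩ := hp
        exact ⟨-q - 2, by push_cast; ring⟩
      rw [e1, e2] at h
      simpa using h

lemma canD_comp (i j : ℕ) (v : V) : canD k i (canD k j v) = (i + j).choose i • canD k (i + j) v := by
  have h := jacobi (k := k) v (vac (k := k) : V) (vac (k := k)) (-1 - j) 0 (-1 - i)
  rw [finsum_eq_range _ 1, Finset.sum_range_one, finsum_eq_range _ (i + 1),
    Finset.sum_range_succ _ i] at h
  · rw [Finset.sum_eq_zero] at h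
    · have h1 : nprod (k := k) (0 + (i : ℤ)) v (vac (k := k) : V) = 0 := creation_nonneg _ _ (by positivity)
      have h2 : (-1 : ℤ) ^ i * Ring.choose (-1 - (j : ℤ)) i = (i + j).choose i := by
        rw [show -1 - (j : ℤ) = -((j : ℤ) + 1) by ring, Ring.choose_neg,
          show (j : ℤ) + 1 + i - 1 = ((i + j : ℕ) : ℤ) by push_cast; ring, Ring.choose_natCast]
        simp only [Int.negOnePow_def, Units.smul_def, zpow_natCast, Units.val_pow_eq_pow_val,
          Units.val_neg, Units.val_one, smul_eq_mul, ← mul_assoc, ← pow_add]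
        simp
      rw [h2] at h
      simp only [Nat.cast_zero, Ring.choose_zero_right, one_smul, sub_zero, add_zero, zero_add, sub_add_cancel, creation_neg_one] at h
      simp only [zero_add] at h1
      rw [h1] at h
      simp only [canD]
      rw [h, show -1 - ((i + j : ℕ) : ℤ) = -1 - (j : ℤ) - i by push_cast; ring]
      simp
    · intro p hp
      rw [Finset.mem_range] at hp
      have h1 : nprod (k := k) (0 + (p : ℤ)) v (vac (k := k) : V) = 0 := creation_nonneg _ _ (by positivity)
      have h3 := canD_vac (k := k) (V := V) (i - p) (by omega)
      unfold canD at h3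
      rw [h1, show -1 - (i : ℤ) + p = -1 - ((i - p : ℕ) : ℤ) by omega, h3]
      simp
  · intro p hp
    have h1 : nprod (k := k) (0 + (p : ℤ)) v (vac (k := k) : V) = 0 := creation_nonneg _ _ (by positivity)
    have h2 : nprod (k := k) (-1 - (i : ℤ) + p) (vac (k := k) : V) (vac (k := k)) = 0 :=
      creation_nonneg _ _ (by omega)
    rw [h1, h2]; simp
  · intro p hp
    rw [Ring.choose_zero_pos _ (by omega)]
    simp

/-- The vacuum identity `Y(1, z) = id`. -/
lemma vac_nprod (n : ℤ) (v : V) : nprod (k := k) n (vac (k := k) : V) v = if n = -1 then v else 0 := by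
  rcases lt_or_ge n 0 with hn | hn
  · obtain ⟨m, rfl⟩ : ∃ m : ℕ, n = -1 - m := ⟨(-1 - n).toNat, by omega⟩
    rw [skew v (vac (k := k) : V) (-1 - m) (m + 1)
      (fun i hi => creation_nonneg _ _ (by omega))]
    have h1 : ∀ i ∈ Finset.range (m + 1), (-1 : ℤ) ^ i •
        nprod (k := k) (-1 - i) (nprod (k := k) (-1 - (m : ℤ) + i) v (vac (k := k))) (vac (k := k))
        = ((-1 : ℤ) ^ i * (m.choose i : ℤ)) • canD k m v := by
      intro i hi
      rw [Finset.mem_range] at hi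
      have h2 := canD_comp (k := k) i (m - i) v
      rw [show i + (m - i) = m by omega] at h2
      rw [mul_smul, natCast_zsmul, ← h2, show -1 - (m : ℤ) + i = -1 - ((m - i : ℕ) : ℤ) by omega]
      rfl
    rw [Finset.sum_congr rfl h1, ← Finset.sum_smul, Int.alternating_sum_range_choose]
    rcases Nat.eq_zero_or_pos m with rfl | hm
    · simp [canD, creation_neg_one]
    · rw [if_neg (by omega), if_neg (by omega)]; simp
  · rw [skew v (vac (k := k) : V) n 0 (fun i hi => creation_nonneg _ _ (by omega)), if_neg (by omega)]
    simp

end Basic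

section BaseChange

open HasseSchmidt

variable {k V S : Type*} [CommRing k] [AddCommGroup V] [Module k V] [VertexAlgebra k V]
  [CommRing S] [Algebra k S] [HasseSchmidt k S]

variable (k V S) in
/-- The bilinear map `(u ⊗ s, v ⊗ t) ↦ u_{n + j} v ⊗ D_j(s) t`. -/
noncomputable def tensorTerm (n : ℤ) (j : ℕ) : V ⊗[k] S →ₗ[k] V ⊗[k] S →ₗ[k] V ⊗[k] S :=
  TensorProduct.map₂ (nprod (k := k) (n + j)) ((LinearMap.mul k S).comp (D j))

@[simp]
lemma tensorTerm_tmul (n : ℤ) (j : ℕ) (u v : V) (s t : S) :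
    tensorTerm k V S n j (u ⊗ₜ s) (v ⊗ₜ t) =
      nprod (k := k) (n + j) u v ⊗ₜ[k] (D (k := k) j s * t) := rfl

lemma tensorTerm_bound (x y : V ⊗[k] S) :
    ∃ N : ℕ, ∀ (n : ℤ) (j : ℕ), (N : ℤ) ≤ n + j → tensorTerm k V S n j x y = 0 := by
  induction x using TensorProduct.induction_on with
  | zero => exact ⟨0, fun n j _ => by simp⟩
  | add x₁ x₂ h₁ h₂ =>
    obtain ⟨N₁, h₁⟩ := h₁
    obtain ⟨N₂, h₂⟩ := h₂
    exact ⟨N₁ + N₂, fun n j h => by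
      rw [map_add, LinearMap.add_apply, h₁ n j (by omega), h₂ n j (by omega), add_zero]⟩
  | tmul u s =>
    induction y using TensorProduct.induction_on with
    | zero => exact ⟨0, fun n j _ => by simp⟩
    | add y₁ y₂ h₁ h₂ =>
      obtain ⟨N₁, h₁⟩ := h₁
      obtain ⟨N₂, h₂⟩ := h₂
      exact ⟨N₁ + N₂, fun n j h => by
        rw [map_add, h₁ n j (by omega), h₂ n j (by omega), add_zero]⟩
    | tmul v t =>
      obtain ⟨N, hN⟩ := exists_bound k u v
      exact ⟨N, fun n j h => by rw [tensorTerm_tmul, hN _ h, TensorProduct.zero_tmul]⟩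

lemma tensorTerm_finite (n : ℤ) (x y : V ⊗[k] S) :
    (Function.support fun j => tensorTerm k V S n j x y).Finite := by
  obtain ⟨N, hN⟩ := tensorTerm_bound x y
  refine (Finset.range ((N : ℤ) - n).toNat).finite_toSet.subset fun j hj => ?_
  simp only [Finset.coe_range, Set.mem_Iio]
  by_contra hc
  exact hj (hN n j (by omega))

variable (k V S) in
/-- The `n`-th product on `V ⊗ S`, characterised by
`(u ⊗ s)_n (v ⊗ t) = ∑_{j ≥ 0} u_{n + j} v ⊗ D_j(s) t`. -/
noncomputable def tensorProd (n : ℤ) : V ⊗[k] S →ₗ[k] V ⊗[k] S →ₗ[k] V ⊗[k] S :=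
  LinearMap.mk₂ k (fun x y => ∑ᶠ j : ℕ, tensorTerm k V S n j x y)
    (fun x x' y => by
      simp only [map_add, LinearMap.add_apply]
      exact finsum_add_distrib (tensorTerm_finite n x y) (tensorTerm_finite n x' y))
    (fun c x y => by
      simp only [map_smul, LinearMap.smul_apply]
      exact (smul_finsum' c (tensorTerm_finite n x y)).symm)
    (fun x y y' => by
      simp only [map_add]
      exact finsum_add_distrib (tensorTerm_finite n x y) (tensorTerm_finite n x y'))
    (fun c x y => by
      simp only [map_smul]
      exact (smul_finsum' c (tensorTerm_finite n x y)).symm)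

lemma tensorProd_tmul (n : ℤ) (u v : V) (s t : S) :
    tensorProd k V S n (u ⊗ₜ s) (v ⊗ₜ t) =
      ∑ᶠ j : ℕ, nprod (k := k) (n + j) u v ⊗ₜ[k] (D (k := k) j s * t) := rfl

lemma tensorProd_tmul_range (n : ℤ) (u v : V) (s t : S) (K : ℕ)
    (h : ∀ j : ℕ, K ≤ j → nprod (k := k) (n + j) u v = 0) :
    tensorProd k V S n (u ⊗ₜ s) (v ⊗ₜ t) =
      ∑ j ∈ Finset.range K, nprod (k := k) (n + j) u v ⊗ₜ[k] (D (k := k) j s * t) := by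
  rw [tensorProd_tmul, finsum_eq_range _ K]
  intro j hj
  rw [h j hj, TensorProduct.zero_tmul]

lemma tensorProd_regular (x y : V ⊗[k] S) :
    ∃ N : ℕ, ∀ n : ℤ, (N : ℤ) ≤ n → tensorProd k V S n x y = 0 := by
  obtain ⟨N, hN⟩ := tensorTerm_bound x y
  refine ⟨N, fun n hn => ?_⟩
  change ∑ᶠ j : ℕ, tensorTerm k V S n j x y = 0
  rw [finsum_eq_range _ 0]
  · simp
  · intro j _; exact hN n j (by omega)

/-- Reindexing a truncated double sum over antidiagonals. -/
lemma sum_antidiag_range {A : Type*} [AddCommMonoid A] (K : ℕ) (f : ℕ → ℕ → A)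
    (h : ∀ q s, K ≤ q + s → f q s = 0) :
    ∑ p ∈ Finset.range K, ∑ x ∈ Finset.HasAntidiagonal.antidiagonal p, f x.1 x.2 =
      ∑ q ∈ Finset.range K, ∑ s ∈ Finset.range K, f q s := by
  simp only [Finset.Nat.sum_antidiagonal_eq_sum_range_succ f]
  rw [Finset.sum_range_diag_flip]
  refine Finset.sum_congr rfl fun q hq => ?_
  refine Finset.sum_subset (Finset.range_mono (Nat.sub_le _ _)) fun s _ hs => h q s ?_
  rw [Finset.mem_range] at hs
  omega

/-- Shifting the index of a truncated sum. -/
lemma sum_shift_range {A : Type*} [AddCommMonoid A] (K j : ℕ) (f : ℕ → A)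
    (h : ∀ q, K ≤ q → f q = 0) (h' : ∀ q, q < j → f q = 0) :
    ∑ q ∈ Finset.range K, f (q + j) = ∑ q ∈ Finset.range K, f q := by
  have h1 : ∑ q ∈ Finset.range (j + K), f q = ∑ q ∈ Finset.range K, f q := by
    symm
    refine Finset.sum_subset (Finset.range_mono (Nat.le_add_left _ _)) fun s _ hs => h s ?_
    rw [Finset.mem_range] at hs
    omega
  rw [← h1, Finset.sum_range_add, Finset.sum_eq_zero (s := Finset.range j), zero_add]
  · exact Finset.sum_congr rfl fun q _ => by rw [add_comm]
  · intro q hq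
    exact h' q (Finset.mem_range.mp hq)


lemma exists_uniform_bound (g : ℕ → ℤ → V) (h1 : ∀ I, ∃ N : ℕ, ∀ p : ℤ, (N : ℤ) ≤ p → g I p = 0)
    (h2 : ∃ A : ℕ, ∀ I, A ≤ I → ∀ p, g I p = 0) :
    ∃ P : ℕ, ∀ I p, (P : ℤ) ≤ p → g I p = 0 := by
  choose N hN using h1
  obtain ⟨A, hA⟩ := h2
  refine ⟨∑ I ∈ Finset.range A, N I, fun I p hp => ?_⟩
  rcases lt_or_ge I A with hI | hI
  · apply hN
    have := Finset.single_le_sum (f := N) (fun _ _ => Nat.zero_le _) (Finset.mem_range.mpr hI)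
    omega
  · exact hA I hI p

lemma exists_bound_shift (u v : V) (n : ℤ) :
    ∃ A : ℕ, ∀ I : ℕ, A ≤ I → nprod (k := k) (n + I) u v = 0 := by
  obtain ⟨N, hN⟩ := exists_bound k u v
  exact ⟨((N : ℤ) - n).toNat, fun I hI => hN _ (by omega)⟩

lemma tensor_lhs (u v w : V) (a b c : S) (l m n : ℤ) :
    ∃ N : ℕ, ∀ K, N ≤ K →
      ∑ i ∈ Finset.range K, Ring.choose m i • tensorProd k V S (m + n - i)
        (tensorProd k V S (l + i) (u ⊗ₜ a) (v ⊗ₜ b)) (w ⊗ₜ c) =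
      ∑ J ∈ Finset.range K, ∑ s ∈ Finset.range K, (∑ I ∈ Finset.range K,
        Ring.choose (m + J) I • nprod (k := k) (m + J + (n + s) - I)
          (nprod (k := k) (l + I) u v) w) ⊗ₜ[k] (D (k := k) J a * D (k := k) s b * c) := by
  obtain ⟨A, hA⟩ := exists_bound_shift (k := k) u v l
  obtain ⟨P, hP⟩ := exists_uniform_bound
    (fun I p => nprod (k := k) p (nprod (k := k) (l + I) u v) w) (fun I => exists_bound k _ _)
    ⟨A, fun I hI p => by simp [hA I hI]⟩
  refine ⟨A + P + (m + n).natAbs, fun K hK => ?_⟩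
  have key : ∀ (I : ℕ) (p : ℤ), (K : ℤ) ≤ p + I →
      nprod (k := k) (m + n + p) (nprod (k := k) (l + I) u v) w = 0 := by
    intro I p hp
    rcases lt_or_ge I A with hI | hI
    · exact hP I _ (by omega)
    · simp [hA I hI]
  set X : ℕ → ℤ → V := fun I p => nprod (k := k) (m + n + p) (nprod (k := k) (l + I) u v) w with hX
  have keyA : ∀ (I : ℕ) (p : ℤ), A ≤ I → X I p = 0 := fun I p hI => by simp [hX, hA I hI]
  set E : ℕ → ℕ → S := fun J s => D (k := k) J a * D (k := k) s b * c with hE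
  -- expand both products
  have step1 : ∀ i : ℕ, tensorProd k V S (m + n - i)
        (tensorProd k V S (l + i) (u ⊗ₜ a) (v ⊗ₜ b)) (w ⊗ₜ c) =
      ∑ j ∈ Finset.range K, ∑ q ∈ Finset.range K, ∑ s ∈ Finset.range K,
        ((q + j).choose j : ℤ) • (X (i + j) ((q + j : ℕ) + s - (i + j : ℕ)) ⊗ₜ[k] E (q + j) s) := by
    intro i
    rw [tensorProd_tmul_range _ _ _ _ _ K, map_sum, LinearMap.sum_apply]
    · refine Finset.sum_congr rfl fun j _ => ?_
      rw [tensorProd_tmul_range _ _ _ _ _ K, ← sum_antidiag_range]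
      · refine Finset.sum_congr rfl fun p _ => ?_
        rw [D_mul, Finset.sum_mul, TensorProduct.tmul_sum]
        refine Finset.sum_congr rfl fun x hx => ?_
        rw [Finset.HasAntidiagonal.mem_antidiagonal] at hx
        rw [D_comp, smul_mul_assoc, smul_mul_assoc, TensorProduct.tmul_smul, natCast_zsmul,
          ← Nat.choose_symm_add]
        subst hx
        simp only [hX, hE]
        rw [show m + n - (i : ℤ) + ((x.1 + x.2 : ℕ) : ℤ) =
            m + n + (((x.1 + j : ℕ) : ℤ) + x.2 - ((i + j : ℕ) : ℤ)) by push_cast; ring,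
          show l + (i : ℤ) + j = l + ((i + j : ℕ) : ℤ) by push_cast; ring]
      · intro q s hqs
        have : X (i + j) ((q + j : ℕ) + s - (i + j : ℕ)) = 0 := key _ _ (by omega)
        rw [this]; simp
      · intro p hp
        have := key (i + j) (-i + p - 0) (by omega)
        rw [show m + n - (i : ℤ) + p = m + n + (-i + p - 0) by ring,
          show l + (i : ℤ) + j = l + ((i + j : ℕ) : ℤ) by push_cast; ring]
        exact this
    · intro j hj
      rw [show l + (i : ℤ) + j = l + ((i + j : ℕ) : ℤ) by push_cast; ring]
      exact hA _ (by omega)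
  have step2 : ∀ i : ℕ, tensorProd k V S (m + n - i)
        (tensorProd k V S (l + i) (u ⊗ₜ a) (v ⊗ₜ b)) (w ⊗ₜ c) =
      ∑ j ∈ Finset.range K, ∑ J ∈ Finset.range K, ∑ s ∈ Finset.range K,
        (J.choose j : ℤ) • (X (i + j) (J + s - (i + j : ℕ)) ⊗ₜ[k] E J s) := by
    intro i
    rw [step1]
    refine Finset.sum_congr rfl fun j _ => ?_
    refine sum_shift_range K j (fun J => ∑ s ∈ Finset.range K,
        (J.choose j : ℤ) • (X (i + j) (J + s - (i + j : ℕ)) ⊗ₜ[k] E J s)) ?_ ?_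
    · intro J hJ
      refine Finset.sum_eq_zero fun s _ => ?_
      have : X (i + j) (J + s - (i + j : ℕ)) = 0 := key _ _ (by omega)
      rw [this]; simp
    · intro J hJ
      simp [Nat.choose_eq_zero_of_lt hJ]
  simp only [step2, Finset.smul_sum]
  calc _ = ∑ J ∈ Finset.range K, ∑ s ∈ Finset.range K, ∑ i ∈ Finset.range K,
        ∑ j ∈ Finset.range K, Ring.choose m i • (J.choose j : ℤ) •
          (X (i + j) (J + s - (i + j : ℕ)) ⊗ₜ[k] E J s) := by
        rw [Finset.sum_comm' (t' := Finset.range K) (s' := fun _ => Finset.range K) (by simp)]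
        rw [Finset.sum_congr rfl fun j _ => Finset.sum_comm]
        rw [Finset.sum_comm]
        refine Finset.sum_congr rfl fun J _ => ?_
        rw [Finset.sum_congr rfl fun j _ => Finset.sum_comm]
        rw [Finset.sum_comm]
        refine Finset.sum_congr rfl fun s _ => ?_
        rw [Finset.sum_comm]
    _ = _ := by
        refine Finset.sum_congr rfl fun J _ => Finset.sum_congr rfl fun s _ => ?_
        rw [← sum_antidiag_range K (fun i j => Ring.choose m i • (J.choose j : ℤ) •
          (X (i + j) (J + s - (i + j : ℕ)) ⊗ₜ[k] E J s)), TensorProduct.sum_tmul]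
        · refine Finset.sum_congr rfl fun I _ => ?_
          rw [Ring.add_choose_eq _ (Commute.all _ _), Finset.sum_smul, TensorProduct.sum_tmul]
          refine Finset.sum_congr rfl fun x hx => ?_
          rw [Finset.HasAntidiagonal.mem_antidiagonal] at hx
          subst hx
          rw [Ring.choose_natCast, mul_smul, TensorProduct.smul_tmul', TensorProduct.smul_tmul']
          simp only [hX]
          rw [show m + n + ((J : ℤ) + s - ((x.1 + x.2 : ℕ) : ℤ)) =
            m + J + (n + s) - ((x.1 + x.2 : ℕ) : ℤ) by ring]
        · intro i j hij
          simp [keyA (i + j) _ (by omega)]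

lemma tensor_rhs (u v w : V) (a b c : S) (l m n : ℤ) :
    ∃ N : ℕ, ∀ K, N ≤ K → ∀ i : ℕ,
      tensorProd k V S (m + l - i) (u ⊗ₜ a) (tensorProd k V S (n + i) (v ⊗ₜ b) (w ⊗ₜ c)) =
      ∑ s ∈ Finset.range K, ∑ J ∈ Finset.range K,
        nprod (k := k) (m + J + l - i) u (nprod (k := k) (n + s + i) v w) ⊗ₜ[k]
          (D (k := k) J a * D (k := k) s b * c) := by
  obtain ⟨A, hA⟩ := exists_bound_shift (k := k) v w n
  obtain ⟨P, hP⟩ := exists_uniform_bound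
    (fun I p => nprod (k := k) p u (nprod (k := k) (n + I) v w)) (fun I => exists_bound k _ _)
    ⟨A, fun I hI p => by simp [hA I hI]⟩
  refine ⟨A + P + (m + l).natAbs, fun K hK i => ?_⟩
  rw [tensorProd_tmul_range _ _ _ _ _ K, map_sum]
  · refine Finset.sum_congr rfl fun s _ => ?_
    rw [tensorProd_tmul_range _ _ _ _ _ K]
    · refine Finset.sum_congr rfl fun J _ => ?_
      rw [mul_assoc, show m + l - (i : ℤ) + J = m + J + l - i by ring,
        show n + (i : ℤ) + s = n + s + i by ring]
    · intro J hJ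
      rw [show n + (i : ℤ) + s = n + ((i + s : ℕ) : ℤ) by push_cast; ring]
      rcases lt_or_ge (i + s) A with hI | hI
      · exact hP (i + s) _ (by omega)
      · rw [hA (i + s) hI, map_zero]
  · intro s hs
    rw [show n + (i : ℤ) + s = n + ((i + s : ℕ) : ℤ) by push_cast; ring]
    exact hA _ (by omega)

lemma tensor_jacobi_range (x y z : V ⊗[k] S) (l m n : ℤ) :
    ∃ N : ℕ, ∀ K, N ≤ K →
      ∑ i ∈ Finset.range K, Ring.choose m i •
        tensorProd k V S (m + n - i) (tensorProd k V S (l + i) x y) z =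
      ∑ i ∈ Finset.range K, ((-1) ^ i * Ring.choose l i) •
        (tensorProd k V S (m + l - i) x (tensorProd k V S (n + i) y z) -
          (l.negOnePow : ℤ) • tensorProd k V S (n + l - i) y (tensorProd k V S (m + i) x z)) := by
  induction x using TensorProduct.induction_on with
  | zero => exact ⟨0, fun K _ => by simp⟩
  | add x₁ x₂ h₁ h₂ =>
    obtain ⟨N₁, h₁⟩ := h₁
    obtain ⟨N₂, h₂⟩ := h₂
    refine ⟨N₁ + N₂, fun K hK => ?_⟩
    have := congrArg₂ (· + ·) (h₁ K (by omega)) (h₂ K (by omega))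
    simp only [← Finset.sum_add_distrib, ← smul_add] at this
    simp only [map_add, LinearMap.add_apply]
    rw [this]
    refine Finset.sum_congr rfl fun i _ => ?_
    congr 1; rw [smul_add]; abel
  | tmul u a =>
  induction y using TensorProduct.induction_on with
  | zero => exact ⟨0, fun K _ => by simp⟩
  | add x₁ x₂ h₁ h₂ =>
    obtain ⟨N₁, h₁⟩ := h₁
    obtain ⟨N₂, h₂⟩ := h₂
    refine ⟨N₁ + N₂, fun K hK => ?_⟩
    have := congrArg₂ (· + ·) (h₁ K (by omega)) (h₂ K (by omega))
    simp only [← Finset.sum_add_distrib, ← smul_add] at this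
    simp only [map_add, LinearMap.add_apply]
    rw [this]
    refine Finset.sum_congr rfl fun i _ => ?_
    congr 1; rw [smul_add]; abel
  | tmul v b =>
  induction z using TensorProduct.induction_on with
  | zero => exact ⟨0, fun K _ => by simp⟩
  | add x₁ x₂ h₁ h₂ =>
    obtain ⟨N₁, h₁⟩ := h₁
    obtain ⟨N₂, h₂⟩ := h₂
    refine ⟨N₁ + N₂, fun K hK => ?_⟩
    have := congrArg₂ (· + ·) (h₁ K (by omega)) (h₂ K (by omega))
    simp only [← Finset.sum_add_distrib, ← smul_add] at this
    simp only [map_add]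
    rw [this]
    refine Finset.sum_congr rfl fun i _ => ?_
    congr 1; rw [smul_add]; abel
  | tmul w c =>
    obtain ⟨N₁, h₁⟩ := tensor_lhs (k := k) u v w a b c l m n
    obtain ⟨N₂, h₂⟩ := tensor_rhs (k := k) u v w a b c l m n
    obtain ⟨N₃, h₃⟩ := tensor_rhs (k := k) v u w b a c l n m
    obtain ⟨A₁, hA₁⟩ := exists_bound_shift (k := k) u v l
    obtain ⟨A₂, hA₂⟩ := exists_bound_shift (k := k) v w n
    obtain ⟨A₃, hA₃⟩ := exists_bound_shift (k := k) u w m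
    refine ⟨N₁ + N₂ + N₃ + A₁ + A₂ + A₃, fun K hK => ?_⟩
    rw [h₁ K (by omega)]
    have hJ : ∀ J s : ℕ, _ := fun J s => jacobi_range (k := k) u v w l (m + J) (n + s) K
      (fun i hi => hA₁ i (by omega))
      (fun i hi => by
        rw [show n + (s : ℤ) + i = n + ((s + i : ℕ) : ℤ) by push_cast; ring]
        exact hA₂ _ (by omega))
      (fun i hi => by
        rw [show m + (J : ℤ) + i = m + ((J + i : ℕ) : ℤ) by push_cast; ring]
        exact hA₃ _ (by omega))
    rw [Finset.sum_congr rfl fun J _ => Finset.sum_congr rfl fun s _ => by rw [hJ J s]]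
    simp only [h₂ K (by omega), h₃ K (by omega)]
    simp only [TensorProduct.sum_tmul]
    rw [Finset.sum_congr rfl fun J _ => Finset.sum_comm, Finset.sum_comm]
    refine Finset.sum_congr rfl fun i _ => ?_
    simp only [← TensorProduct.smul_tmul', ← Finset.smul_sum, TensorProduct.sub_tmul,
      Finset.sum_sub_distrib]
    congr 2
    · rw [Finset.sum_comm]
    · congr 1
      refine Finset.sum_congr rfl fun J _ => Finset.sum_congr rfl fun s _ => ?_
      rw [mul_comm (D (k := k) J a)]

/-- Base change `V ⊗ S` of a vertex algebra `V` over `k` along a commutative `k`-algebra `S` with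
iterative Hasse-Schmidt derivation. -/
noncomputable instance baseChange : VertexAlgebra k (V ⊗[k] S) where
  nprod := tensorProd k V S
  vac := vac (k := k) ⊗ₜ 1
  regular x y := by
    obtain ⟨N, hN⟩ := tensorProd_regular x y
    exact ⟨N, hN⟩
  creation_nonneg x n hn := by
    induction x using TensorProduct.induction_on with
    | zero => simp
    | add x₁ x₂ h₁ h₂ => rw [map_add, LinearMap.add_apply, h₁, h₂, add_zero]
    | tmul v s =>
      rw [tensorProd_tmul_range _ _ _ _ _ 0]
      · simp
      · intro j _; exact creation_nonneg _ _ (by omega)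
  creation_neg_one x := by
    induction x using TensorProduct.induction_on with
    | zero => simp
    | add x₁ x₂ h₁ h₂ => rw [map_add, LinearMap.add_apply, h₁, h₂]
    | tmul v s =>
      rw [tensorProd_tmul_range _ _ _ _ _ 1]
      · simp [creation_neg_one, D_zero]
      · intro j _; exact creation_nonneg _ _ (by omega)
  jacobi x y z l m n := by
    obtain ⟨N, hN⟩ := tensor_jacobi_range x y z l m n
    obtain ⟨N₁, hN₁⟩ := tensorProd_regular x y
    obtain ⟨N₂, hN₂⟩ := tensorProd_regular y z
    obtain ⟨N₃, hN₃⟩ := tensorProd_regular x z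
    have := hN (N + N₁ + N₂ + N₃ + l.natAbs + m.natAbs + n.natAbs) (by omega)
    rwa [← finsum_eq_range, ← finsum_eq_range] at this
    · intro i hi
      rw [hN₂ (n + i) (by omega), hN₃ (m + i) (by omega)]
      simp
    · intro i hi
      rw [hN₁ (l + i) (by omega)]
      simp

end BaseChange

section Algebras

variable {k V : Type*} [CommRing k] [AddCommGroup V] [Module k V] [VertexAlgebra k V]

/-- Membership in the centre: `v_n u = 0 = u_n v` for all `u` and all `n ≥ 0`. -/
def IsCentral (k : Type*) {V : Type*} [CommRing k] [AddCommGroup V] [Module k V]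
    [VertexAlgebra k V] (v : V) : Prop :=
  ∀ (u : V) (n : ℤ), 0 ≤ n → nprod (k := k) n v u = 0 ∧ nprod (k := k) n u v = 0

variable (k V) in
/-- Automorphisms of a vertex algebra over `k`. -/
structure Aut extends V ≃ₗ[k] V where
  map_nprod : ∀ (n : ℤ) (u v : V),
    toFun (nprod (k := k) n u v) = nprod (k := k) n (toFun u) (toFun v)
  map_vac : toFun (vac (k := k)) = vac (k := k)

/-- A submodule containing the vacuum and closed under all products is a vertex algebra. -/
@[reducible]
def ofSubmodule (p : Submodule k V) (h1 : vac (k := k) ∈ p)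
    (h2 : ∀ (n : ℤ), ∀ u ∈ p, ∀ v ∈ p, nprod (k := k) n u v ∈ p) : VertexAlgebra k p where
  nprod n := LinearMap.mk₂ k
    (fun u v => (⟨nprod (k := k) n (u : V) (v : V), h2 n u u.2 v v.2⟩ : p))
    (fun _ _ _ => Subtype.ext (by simp)) (fun _ _ _ => Subtype.ext (by simp))
    (fun _ _ _ => Subtype.ext (by simp)) (fun _ _ _ => Subtype.ext (by simp))
  vac := ⟨vac (k := k), h1⟩
  regular u v := by
    obtain ⟨N, hN⟩ := regular (k := k) (u : V) v
    exact ⟨N, fun n hn => Subtype.ext (hN n hn)⟩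
  creation_nonneg v n hn := Subtype.ext (creation_nonneg (k := k) (v : V) n hn)
  creation_neg_one v := Subtype.ext (creation_neg_one (k := k) (v : V))
  jacobi u v w l m n := by
    apply p.subtype_injective
    have e := fun f : ℕ → p =>
      p.subtype.toAddMonoidHom.map_finsum_of_injective p.subtype_injective f
    simp only [LinearMap.toAddMonoidHom_coe] at e
    rw [e, e]
    simpa using jacobi (k := k) (u : V) v w l m n

end Algebras

/-- The structure on a vertex algebra `V` over `k` of a vertex algebra over the commutative vertex
ring `R` given by a `k`-algebra with Hasse-Schmidt derivation: a homomorphism `ι : R → V` of vertex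
rings with values in the centre of `V`. -/
class OverBase (k R V : Type*) [CommRing k] [CommRing R] [Algebra k R] [HasseSchmidt k R]
    [AddCommGroup V] [Module k V] [VertexAlgebra k V] where
  ι : R →ₗ[k] V
  ι_one : ι 1 = vac (k := k)
  ι_nprod : ∀ (n : ℤ) (r s : R),
    ι (HasseSchmidt.nprod k n r s) = nprod (k := k) n (ι r) (ι s)
  ι_central : ∀ r : R, IsCentral k (ι r)

/-- Homomorphisms of vertex algebras over `R`: homomorphisms of vertex rings (additive maps
preserving all products and the vacuum) that commute with the structure maps from `R`. -/
structure OverBase.Hom (k R V W : Type*) [CommRing k] [CommRing R] [Algebra k R] [HasseSchmidt k R]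
    [AddCommGroup V] [Module k V] [VertexAlgebra k V] [OverBase k R V]
    [AddCommGroup W] [Module k W] [VertexAlgebra k W] [OverBase k R W] extends V →+ W where
  map_nprod : ∀ (n : ℤ) (u v : V),
    toFun (nprod (k := k) n u v) = nprod (k := k) n (toFun u) (toFun v)
  map_vac : toFun (vac (k := k)) = vac (k := k)
  map_ι : ∀ r : R, toFun (OverBase.ι (k := k) r) = OverBase.ι (k := k) r

end VertexAlgebra

/-- The ring `k[t^{±1/M}]`: Laurent polynomials in `t^{1/M}`. -/
def RootLaurent (k : Type*) [Field k] (_M : ℕ) : Type _ := LaurentPolynomial k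

namespace RootLaurent

variable {k : Type*} [Field k]

noncomputable instance (M : ℕ) : CommRing (RootLaurent k M) :=
  inferInstanceAs (CommRing (LaurentPolynomial k))

noncomputable instance (M : ℕ) : Algebra k (RootLaurent k M) :=
  inferInstanceAs (Algebra k (LaurentPolynomial k))

/-- The monomial `t^{a/M}`. -/
noncomputable def t (M : ℕ) (a : ℤ) : RootLaurent k M := (LaurentPolynomial.T a : LaurentPolynomial k)

variable (k) in
/-- The basis of monomials `t^{a/M}`, `a ∈ ℤ`. -/
noncomputable def basis (M : ℕ) : Module.Basis ℤ k (RootLaurent k M) :=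
  (AddMonoidAlgebra.basis ℤ k : Module.Basis ℤ k (LaurentPolynomial k))

@[simp] lemma basis_apply (M : ℕ) (a : ℤ) : basis k M a = t M a :=
  AddMonoidAlgebra.basis_apply k a

lemma t_add (M : ℕ) (a b : ℤ) : (t M (a + b) : RootLaurent k M) = t M a * t M b :=
  LaurentPolynomial.T_add a b

lemma t_zero (M : ℕ) : (t M 0 : RootLaurent k M) = 1 := LaurentPolynomial.T_zero

/-- The algebra map `k[t^{±1/M}] → A` attached to the images of the monomials `t^{a/M}`. -/
noncomputable def liftHom {A : Type*} [CommRing A] [Algebra k A] (M : ℕ) (f : ℤ → A)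
    (h0 : f 0 = 1) (hadd : ∀ a b, f (a + b) = f a * f b) : RootLaurent k M →ₐ[k] A :=
  (AddMonoidAlgebra.lift k A ℤ
    { toFun := fun a => f a.toAdd, map_one' := h0, map_mul' := fun a b => hadd _ _ } :
      LaurentPolynomial k →ₐ[k] A)

@[simp] lemma liftHom_t {A : Type*} [CommRing A] [Algebra k A] (M : ℕ) (f : ℤ → A)
    (h0 : f 0 = 1) (hadd : ∀ a b, f (a + b) = f a * f b) (a : ℤ) :
    liftHom (k := k) M f h0 hadd (t M a) = f a := by
  unfold liftHom t LaurentPolynomial.T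
  exact (AddMonoidAlgebra.lift_single _ _ _).trans (one_smul k _)

/-- The automorphism `γ` of `k[t^{±1/M}]` with `t^{1/M} ↦ ζ t^{1/M}`. -/
noncomputable def galois {M : ℕ} [NeZero M] {ζ : k} (hζ : IsPrimitiveRoot ζ M) :
    RootLaurent k M →ₐ[k] RootLaurent k M :=
  liftHom M (fun a => ζ ^ a • t M a) (by simp [t_zero]) (fun a b => by
    rw [zpow_add₀ (hζ.ne_zero (NeZero.ne M)), t_add, smul_mul_smul_comm])

/-- The inclusion `k[t^{±1}] → k[t^{±1/M}]`. -/
noncomputable def incl (M : ℕ) : RootLaurent k 1 →ₐ[k] RootLaurent k M :=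
  liftHom 1 (fun a => t M (M * a)) (by simp [t_zero]) (fun _ _ => by rw [mul_add, t_add])

variable [CharZero k]

/-- The divided power `D_j` of `d/dt`: `D_j (t^q) = (q choose j) t^{q - j}`, where `q = a/M`. -/
noncomputable def divD (M : ℕ) (j : ℕ) : RootLaurent k M →ₗ[k] RootLaurent k M :=
  (basis k M).constr k fun a => Ring.choose ((a : k) / (M : k)) j • t M (a - j * M)

@[simp] lemma divD_t (M : ℕ) (j : ℕ) (a : ℤ) :
    divD M j (t M a : RootLaurent k M) = Ring.choose ((a : k) / (M : k)) j • t M (a - j * M) := by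
  rw [← basis_apply, divD, Module.Basis.constr_basis]

noncomputable instance (M : ℕ) [NeZero M] : HasseSchmidt k (RootLaurent k M) where
  D := divD M
  D_zero s := by
    suffices h : divD M 0 = (LinearMap.id : RootLaurent k M →ₗ[k] RootLaurent k M) by rw [h]; rfl
    refine (basis k M).ext fun a => ?_
    simp
  D_mul n s t' := by
    suffices h : (LinearMap.mul k (RootLaurent k M)).compr₂ (divD M n) =
        ∑ p ∈ Finset.HasAntidiagonal.antidiagonal n,
          (LinearMap.mul k (RootLaurent k M)).compl₁₂ (divD M p.1) (divD M p.2) by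
      have := LinearMap.congr_fun₂ h s t'
      simpa [LinearMap.sum_apply] using this
    refine (basis k M).ext fun a => (basis k M).ext fun b => ?_
    simp only [basis_apply, LinearMap.compr₂_apply, LinearMap.mul_apply', LinearMap.sum_apply,
      LinearMap.compl₁₂_apply, divD_t, ← t_add]
    rw [Int.cast_add, add_div, Ring.add_choose_eq _ (Commute.all _ _), Finset.sum_smul]
    refine Finset.sum_congr rfl fun p hp => ?_
    rw [Finset.HasAntidiagonal.mem_antidiagonal] at hp
    subst hp
    rw [smul_mul_smul_comm, ← t_add]
    congr 2
    push_cast; ring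
  D_comp i j s := by
    suffices h : divD M i ∘ₗ divD M j = (i + j).choose i • divD (k := k) M (i + j) by
      exact LinearMap.congr_fun h s
    refine (basis k M).ext fun a => ?_
    have hM : (M : k) ≠ 0 := Nat.cast_ne_zero.mpr (NeZero.ne M)
    have hc := Ring.choose_smul_choose ((a : k) / (M : k)) (Nat.le_add_left j i)
    rw [nsmul_eq_mul] at hc
    simp only [basis_apply, LinearMap.comp_apply, divD_t, map_smul, LinearMap.smul_apply,
      smul_smul]
    rw [Nat.choose_symm_add, ← Nat.cast_smul_eq_nsmul k, smul_smul, hc]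
    congr 2
    · congr 2
      · push_cast; field_simp
      · omega
    · push_cast; ring

lemma D_t (M : ℕ) [NeZero M] (j : ℕ) (a : ℤ) :
    HasseSchmidt.D (k := k) j (t M a : RootLaurent k M) =
      Ring.choose ((a : k) / (M : k)) j • t M (a - j * M) := divD_t M j a

lemma D_galois {M : ℕ} [NeZero M] {ζ : k} (hζ : IsPrimitiveRoot ζ M) (j : ℕ)
    (s : RootLaurent k M) :
    galois hζ (HasseSchmidt.D (k := k) j s) = HasseSchmidt.D (k := k) j (galois hζ s) := by
  suffices h : (galois hζ).toLinearMap ∘ₗ HasseSchmidt.D (k := k) j =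
      HasseSchmidt.D (k := k) j ∘ₗ (galois hζ).toLinearMap from LinearMap.congr_fun h s
  refine (basis k M).ext fun a => ?_
  have : ζ ^ (a - j * M) = ζ ^ a := by
    rw [zpow_sub₀ (hζ.ne_zero (NeZero.ne M)), mul_comm (j : ℤ), zpow_mul, zpow_natCast ζ M,
      hζ.pow_eq_one, one_zpow, div_one]
  simp only [galois, basis_apply, LinearMap.comp_apply, AlgHom.toLinearMap_apply, D_t, map_smul,
    liftHom_t, this]
  rw [smul_comm]

lemma D_incl (M : ℕ) [NeZero M] (j : ℕ) (s : RootLaurent k 1) :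
    incl M (HasseSchmidt.D (k := k) j s) = HasseSchmidt.D (k := k) j (incl M s) := by
  suffices h : (incl M).toLinearMap ∘ₗ HasseSchmidt.D (k := k) j =
      HasseSchmidt.D (k := k) j ∘ₗ (incl (k := k) M).toLinearMap from LinearMap.congr_fun h s
  refine (basis k 1).ext fun a => ?_
  have hM : (M : k) ≠ 0 := Nat.cast_ne_zero.mpr (NeZero.ne M)
  simp only [basis_apply, LinearMap.comp_apply, AlgHom.toLinearMap_apply, D_t, map_smul, incl,
    liftHom_t]
  congr 2
  · push_cast; field_simp
  · push_cast; ring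

lemma galois_incl {M : ℕ} [NeZero M] {ζ : k} (hζ : IsPrimitiveRoot ζ M) (s : RootLaurent k 1) :
    galois hζ (incl M s) = incl M s := by
  suffices h : (galois hζ).toLinearMap ∘ₗ (incl M).toLinearMap = (incl (k := k) M).toLinearMap from
    LinearMap.congr_fun h s
  refine (basis k 1).ext fun a => ?_
  have : ζ ^ ((M : ℤ) * a) = 1 := by rw [zpow_mul, zpow_natCast, hζ.pow_eq_one, one_zpow]
  simp [galois, incl, this]

end RootLaurent

namespace VertexAlgebra

section Loop

variable {k V : Type*} [Field k] [CharZero k] [AddCommGroup V] [Module k V] [VertexAlgebra k V]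
  {M : ℕ} [NeZero M] {ζ : k}

/-- The map `g ⊗ γ` on `V ⊗ k[t^{±1/M}]`. -/
noncomputable def loopAut (g : Aut k V) (hζ : IsPrimitiveRoot ζ M) :
    V ⊗[k] RootLaurent k M →ₗ[k] V ⊗[k] RootLaurent k M :=
  TensorProduct.map g.toLinearEquiv.toLinearMap (RootLaurent.galois hζ).toLinearMap

lemma loopAut_tmul (g : Aut k V) (hζ : IsPrimitiveRoot ζ M) (v : V) (s : RootLaurent k M) :
    loopAut g hζ (v ⊗ₜ s) = g.toLinearEquiv v ⊗ₜ RootLaurent.galois hζ s := rfl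

lemma loopAut_nprod (g : Aut k V) (hζ : IsPrimitiveRoot ζ M) (n : ℤ)
    (x y : V ⊗[k] RootLaurent k M) :
    loopAut g hζ (nprod (k := k) n x y) = nprod (k := k) n (loopAut g hζ x) (loopAut g hζ y) := by
  induction x using TensorProduct.induction_on with
  | zero => simp
  | add x₁ x₂ h₁ h₂ => simp only [map_add, LinearMap.add_apply, h₁, h₂]
  | tmul u s =>
  induction y using TensorProduct.induction_on with
  | zero => simp
  | add x₁ x₂ h₁ h₂ => simp only [map_add, h₁, h₂]
  | tmul v t =>
    obtain ⟨K, hK⟩ := exists_bound_shift (k := k) u v n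
    have hg : ∀ (m : ℤ) (a b : V), g.toLinearEquiv (nprod (k := k) m a b) =
      nprod (k := k) m (g.toLinearEquiv a) (g.toLinearEquiv b) := g.map_nprod
    change loopAut g hζ (tensorProd k V _ n _ _) = tensorProd k V _ n _ _
    rw [loopAut_tmul, loopAut_tmul, tensorProd_tmul_range _ _ _ _ _ K hK,
      tensorProd_tmul_range _ _ _ _ _ K (fun j hj => by rw [← hg, hK j hj, map_zero]), map_sum]
    refine Finset.sum_congr rfl fun j _ => ?_
    rw [loopAut_tmul, hg, map_mul, RootLaurent.D_galois]

/-- The twisted loop vertex algebra `L(V, g)`: the fixed points of `g ⊗ γ` on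
`V ⊗ k[t^{±1/M}]`. -/
noncomputable def Loop (g : Aut k V) (hζ : IsPrimitiveRoot ζ M) :
    Submodule k (V ⊗[k] RootLaurent k M) :=
  LinearMap.eqLocus (loopAut g hζ) LinearMap.id

lemma mem_Loop (g : Aut k V) (hζ : IsPrimitiveRoot ζ M) (x : V ⊗[k] RootLaurent k M) :
    x ∈ Loop g hζ ↔ loopAut g hζ x = x := Iff.rfl

lemma one_tmul_mem_Loop (g : Aut k V) (hζ : IsPrimitiveRoot ζ M) (r : RootLaurent k 1) :
    (vac (k := k) : V) ⊗ₜ[k] RootLaurent.incl M r ∈ Loop g hζ := by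
  have hg : g.toLinearEquiv (vac (k := k)) = vac (k := k) := g.map_vac
  rw [mem_Loop, loopAut_tmul, RootLaurent.galois_incl, hg]

noncomputable instance (g : Aut k V) (hζ : IsPrimitiveRoot ζ M) : VertexAlgebra k (Loop g hζ) :=
  ofSubmodule (Loop g hζ)
    (by
      have := one_tmul_mem_Loop g hζ 1
      rw [map_one] at this
      exact this)
    (fun n x hx y hy => by
      rw [mem_Loop] at *
      rw [loopAut_nprod, hx, hy])

lemma coe_nprod (g : Aut k V) (hζ : IsPrimitiveRoot ζ M) (n : ℤ) (x y : Loop g hζ) :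
    ((nprod (k := k) n x y : Loop g hζ) : V ⊗[k] RootLaurent k M) =
      nprod (k := k) n (x : V ⊗[k] RootLaurent k M) (y : V ⊗[k] RootLaurent k M) := rfl

lemma isCentral_one_tmul (s : RootLaurent k M) :
    IsCentral k ((vac (k := k) : V) ⊗ₜ[k] s) := by
  intro y n hn
  induction y using TensorProduct.induction_on with
  | zero => simp
  | add y₁ y₂ h₁ h₂ => simp [h₁, h₂]
  | tmul v t =>
    constructor
    · refine (tensorProd_tmul_range _ _ _ _ _ 0 fun j _ => ?_).trans (by simp)
      rw [vac_nprod, if_neg (by omega)]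
    · refine (tensorProd_tmul_range _ _ _ _ _ 0 fun j _ => ?_).trans (by simp)
      exact creation_nonneg _ _ (by omega)

/-- The structure of a `k[t^{±1}]`-vertex algebra on `L(V, g)`, given by `r ↦ 1 ⊗ r`. -/
noncomputable instance (g : Aut k V) (hζ : IsPrimitiveRoot ζ M) :
    OverBase k (RootLaurent k 1) (Loop g hζ) where
  ι := LinearMap.codRestrict (Loop g hζ)
    ((TensorProduct.mk k V (RootLaurent k M) (vac (k := k))).comp (RootLaurent.incl M).toLinearMap)
    (one_tmul_mem_Loop g hζ)
  ι_one := Subtype.ext (by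
    change (vac (k := k) : V) ⊗ₜ[k] RootLaurent.incl M 1 = (vac (k := k) : V) ⊗ₜ[k] 1
    rw [map_one])
  ι_nprod n r s := Subtype.ext (by
    change (vac (k := k) : V) ⊗ₜ[k] RootLaurent.incl M (HasseSchmidt.nprod k n r s) =
      tensorProd k V _ n (vac (k := k) ⊗ₜ RootLaurent.incl M r)
        (vac (k := k) ⊗ₜ RootLaurent.incl M s)
    unfold HasseSchmidt.nprod
    rcases lt_or_ge n 0 with hn | hn
    · obtain ⟨m, rfl⟩ : ∃ m : ℕ, n = -1 - m := ⟨(-1 - n).toNat, by omega⟩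
      rw [if_pos hn, tensorProd_tmul_range _ _ _ _ _ (m + 1), Finset.sum_range_succ,
        Finset.sum_eq_zero]
      · rw [vac_nprod, if_pos (by omega), map_mul, RootLaurent.D_incl, zero_add,
          show (-(-1 - (m : ℤ)) - 1).toNat = m by omega]
      · intro j hj
        rw [Finset.mem_range] at hj
        rw [vac_nprod, if_neg (by omega), TensorProduct.zero_tmul]
      · intro j hj
        rw [vac_nprod, if_neg (by omega)]
    · rw [if_neg (by omega), tensorProd_tmul_range _ _ _ _ _ 0]
      · simp
      · intro j hj
        rw [vac_nprod, if_neg (by omega)])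
  ι_central r y n hn :=
    ⟨Subtype.ext (isCentral_one_tmul (RootLaurent.incl M r) (y : V ⊗[k] RootLaurent k M) n hn).1,
      Subtype.ext (isCentral_one_tmul (RootLaurent.incl M r) (y : V ⊗[k] RootLaurent k M) n hn).2⟩

/-- The eigenspace `V^{g,a} = {v | g v = ζ^{-a} v}`; it depends only on `a` modulo `M`. -/
noncomputable def eigen (g : Aut k V) (ζ : k) (a : ℤ) : Submodule k V :=
  Module.End.eigenspace g.toLinearEquiv.toLinearMap (ζ ^ (-a))

lemma tmul_t_mem_Loop (g : Aut k V) (hζ : IsPrimitiveRoot ζ M) (a : ℤ) (v : eigen g ζ a) :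
    (v : V) ⊗ₜ[k] RootLaurent.t M a ∈ Loop g hζ := by
  have hv : g.toLinearEquiv (v : V) = ζ ^ (-a) • (v : V) := Module.End.mem_eigenspace_iff.mp v.2
  have h1 : ζ ^ (-a) * ζ ^ a = 1 := by
    rw [← zpow_add₀ (hζ.ne_zero (NeZero.ne M)), neg_add_cancel, zpow_zero]
  rw [mem_Loop, loopAut_tmul, hv, RootLaurent.galois, RootLaurent.liftHom_t,
    TensorProduct.smul_tmul_smul, h1, one_smul]

/-- The element `v_{(n)} = v ⊗ t^n` of `L(V, g)`, for `n = a/M` and `v ∈ V^{g,a}`. -/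
noncomputable def loopElt (g : Aut k V) (hζ : IsPrimitiveRoot ζ M) (a : ℤ) (v : eigen g ζ a) :
    Loop g hζ :=
  ⟨(v : V) ⊗ₜ[k] RootLaurent.t M a, tmul_t_mem_Loop g hζ a v⟩

variable {W : Type*} [AddCommGroup W] [Module k W]

/-- `IsWeakTwistedModule g M ζ Y` says that `Y` makes `W` into a weak `g`-twisted `V`-module. Here
`g` has period `M`, `ζ` is a primitive `M`-th root of unity, and `Y a v` stands for the coefficient
`v_n`, `n = a/M`, of `z ^ (-n - 1)` in `Y_W(v, z) = ∑_{n ∈ (1/M)ℤ} v_n z ^ (-n - 1)`. The Jacobi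
identity is written out in coefficients; its left-hand side comes from the expansion of
`z₂⁻¹ ((z₁ - z₀) / z₂) ^ (-r/M) δ ((z₁ - z₀) / z₂) Y_W(Y(u, z₀) v, z₂)` for `u ∈ V^{g,r}`. -/
structure IsWeakTwistedModule (g : Aut k V) (M : ℕ) (ζ : k) (Y : ℤ → V →ₗ[k] Module.End k W) :
    Prop where
  /-- `Y_W(v, z) = ∑_{n ∈ r/M + ℤ} v_n z ^ (-n - 1)` for `v ∈ V^{g,r}`. -/
  support : ∀ (r a : ℤ), ∀ v ∈ eigen g ζ r, ¬ a ≡ r [ZMOD M] → Y a v = 0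
  /-- `v_n w = 0` for `n` large. -/
  regular : ∀ (v : V) (w : W), ∃ N : ℤ, ∀ a : ℤ, N ≤ a → Y a v w = 0
  /-- `Y_W(1, z) = id`. -/
  vacuum : ∀ a : ℤ, Y a (vac (k := k)) = if a = -M then 1 else 0
  jacobi : ∀ (a b l : ℤ), ∀ u ∈ eigen g ζ a, ∀ (v : V) (w : W),
    ∑ᶠ i : ℕ, Ring.choose ((a : k) / (M : k)) i •
      Y (a + b - i * M) (nprod (k := k) (l + i) u v) w =
    ∑ᶠ i : ℕ, ((-1) ^ i * Ring.choose l i) •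
      (Y (a + (l - i) * M) u (Y (b + i * M) v w) -
        (l.negOnePow : ℤ) • Y (b + (l - i) * M) v (Y (a + i * M) u w))

/-- The linear map `L(V, h) → End W` with `v_{(n)} ↦ v_n`. -/
noncomputable def modeMap (h : Aut k V) (hζ : IsPrimitiveRoot ζ M)
    (Y : ℤ → V →ₗ[k] Module.End k W) : Loop h hζ →ₗ[k] Module.End k W :=
  (TensorProduct.lift ((RootLaurent.basis k M).constr k Y).flip).comp (Loop h hζ).subtype

/-- `modeMap` sends `v_{(n)}` to `v_n`. -/
lemma modeMap_loopElt (h : Aut k V) (hζ : IsPrimitiveRoot ζ M) (Y : ℤ → V →ₗ[k] Module.End k W)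
    (a : ℤ) (v : eigen h ζ a) : modeMap h hζ Y (loopElt h hζ a v) = Y a v := by
  simp only [modeMap, loopElt, LinearMap.comp_apply, Submodule.subtype_apply,
    TensorProduct.lift.tmul, LinearMap.flip_apply, ← RootLaurent.basis_apply,
    Module.Basis.constr_basis]

/-- `IsPullback φ Y Y'` says that `Y'` is `φ^* Y`, that is
`Y'(v, z) = ∑_{n ∈ r/M + ℤ} φ̄(v_{(n)}) z ^ (-n - 1)` for `v ∈ V^{g,r}`, where `φ̄` is the composite
of `φ : L(V, g) → L(V, h)` with `L(V, h) → End W`, `v_{(n)} ↦ v_n`. -/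
structure IsPullback {g h : Aut k V} {hζ : IsPrimitiveRoot ζ M}
    (φ : OverBase.Hom k (RootLaurent k 1) (Loop g hζ) (Loop h hζ))
    (Y Y' : ℤ → V →ₗ[k] Module.End k W) : Prop where
  mode : ∀ (a : ℤ) (v : eigen g ζ a),
    Y' a v = modeMap h hζ Y (φ.toAddMonoidHom (loopElt g hζ a v))
  support : ∀ (r a : ℤ), ∀ v ∈ eigen g ζ r, ¬ a ≡ r [ZMOD M] → Y' a v = 0

end Loop
end VertexAlgebra

/-! The twisted Jacobi identity is really a statement about the loop algebra. Put x = u ⊗ t^{a/M}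
with u in V^{h,a}, y = v ⊗ t^{b/M}, and let m be the linear map v ⊗ t^n ↦ v_n. Since the divided
derivative D_i sends t^{a/M} to binom(a/M, i) t^{a/M - i}, the left side of the identity is m(x_l
y), and the right side is the sum over i of (-1)^i binom(l, i) (m(t^{l-i} x) m(t^i y) - (-1)^l
m(t^{l-i} y) m(t^i x)). Only products and integral powers of t occur (`tensorMode_jacobi`). A map φ
over k[t^{±1}] respects both, because multiplication by t^q is the (-1)-st product with the image of
t^q under the structure map (`nprod_ι_t`, `OverBase.Hom.map_loopMulT`). Inserting φ(x) and φ(y)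
therefore gives the identity for the pullback. Truncation is inherited in the same way, and the
vacuum axiom holds because 1 ⊗ t^q lies in the image of the structure map.

The second vector v is arbitrary, so y need not lie in L(V,g). Averaging over the powers of g ⊗ γ
projects onto L(V,g), and this projection commutes with products by elements of L(V,g)
(`loopProj_nprod`) and with t^q (`loopProj_mulT`). The pullback is m ∘ φ ∘ projection. The
projection kills v ⊗ t^n when v is in V^{g,r} and n is not in r/M + ℤ, which gives the support
condition. Uniqueness holds because V is the sum of the eigenspaces of g (`sum_average_smul`,
`average_mem_eigen`). -/

namespace VertexAlgebra

/-! ### Averaging over a cyclic group of operators. -/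

section Average

variable {k U U' : Type*} [Field k] [AddCommGroup U] [Module k U] [AddCommGroup U'] [Module k U']

/-- The mean of the first `M` powers of an endomorphism. -/
noncomputable def average (M : ℕ) (A : Module.End k U) : Module.End k U :=
  (M : k)⁻¹ • ∑ j ∈ Finset.range M, A ^ j

lemma average_apply (M : ℕ) (A : Module.End k U) (x : U) :
    average M A x = (M : k)⁻¹ • ∑ j ∈ Finset.range M, (A ^ j) x := by
  simp [average, LinearMap.sum_apply]

/-- Applying A shifts the summands cyclically, since A^M = A^0: the sum of A^0, ..., A^M is split
off at either end and compared. -/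
lemma apply_average {M : ℕ} {A : Module.End k U} (hA : A ^ M = 1) (x : U) :
    A (average M A x) = average M A x := by
  rw [average_apply, map_smul, map_sum]
  congr 1
  have h1 := Finset.sum_range_succ (fun j => (A ^ j) x) M
  rw [Finset.sum_range_succ', hA, pow_zero, add_left_inj] at h1
  rw [← h1]
  exact Finset.sum_congr rfl fun j _ => by rw [pow_succ']; rfl

lemma pow_apply_eq_smul {A : Module.End k U} {x : U} {c : k} (h : A x = c • x) (j : ℕ) :
    (A ^ j) x = c ^ j • x := by
  induction j with
  | zero => simp
  | succ j ih => rw [pow_succ', Module.End.mul_apply, ih, map_smul, h, smul_smul, pow_succ]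

lemma average_of_apply_eq [CharZero k] {M : ℕ} [NeZero M] {A : Module.End k U} {x : U}
    (h : A x = x) : average M A x = x := by
  have hM : (M : k) ≠ 0 := Nat.cast_ne_zero.mpr (NeZero.ne M)
  rw [average_apply, Finset.sum_congr rfl fun j _ =>
    (pow_apply_eq_smul (c := 1) (by rw [h, one_smul]) j)]
  simp only [one_pow, one_smul, Finset.sum_const, Finset.card_range]
  rw [← Nat.cast_smul_eq_nsmul k, inv_smul_smul₀ hM]

/-- The average is a multiple of the geometric sum 1 + c + ... + c^{M-1} = (c^M - 1)/(c - 1). -/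
lemma average_eq_zero {M : ℕ} {A : Module.End k U} {x : U} {c : k} (h : A x = c • x)
    (hc : c ^ M = 1) (hc1 : c ≠ 1) : average M A x = 0 := by
  rw [average_apply, Finset.sum_congr rfl fun j _ => pow_apply_eq_smul h j, ← Finset.sum_smul,
    geom_sum_eq hc1, hc, sub_self, zero_div, zero_smul, smul_zero]

lemma apply_pow_of_comm {A : Module.End k U} {A' : Module.End k U'} (B : U →ₗ[k] U')
    (h : ∀ x, B (A x) = A' (B x)) (j : ℕ) (x : U) : B ((A ^ j) x) = (A' ^ j) (B x) := by
  induction j generalizing x with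
  | zero => simp
  | succ j ih => rw [pow_succ, Module.End.mul_apply, ih, h, pow_succ, Module.End.mul_apply]

/-- Every compatibility of the projection onto the loop algebra comes from here, with B a product
with a fixed element, multiplication by t^q, or v ↦ v ⊗ t^{a/M}. -/
lemma apply_average_of_comm {A : Module.End k U} {A' : Module.End k U'} (B : U →ₗ[k] U')
    (h : ∀ x, B (A x) = A' (B x)) (M : ℕ) (x : U) : B (average M A x) = average M A' (B x) := by
  rw [average_apply, average_apply, map_smul, map_sum]
  congr 1
  exact Finset.sum_congr rfl fun j _ => apply_pow_of_comm B h j x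

/-- The averages of the multiples `ζ ^ s • A` add up to the identity. -/
lemma sum_average_smul [CharZero k] {M : ℕ} [NeZero M] {ζ : k} (hζ : IsPrimitiveRoot ζ M)
    (A : Module.End k U) (x : U) :
    ∑ s ∈ Finset.range M, average M (ζ ^ s • A) x = x := by
  have hM : (M : k) ≠ 0 := Nat.cast_ne_zero.mpr (NeZero.ne M)
  simp only [average_apply, ← Finset.smul_sum]
  -- The coefficient of A^j is a multiple of the sum over s of (ζ^j)^s, which vanishes for 0 < j <
  -- M.
  rw [Finset.sum_comm, Finset.sum_eq_single 0]
  · simp only [pow_zero, Module.End.one_apply, Finset.sum_const, Finset.card_range]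
    rw [← Nat.cast_smul_eq_nsmul k, inv_smul_smul₀ hM]
  · intro j hj hj0
    rw [Finset.mem_range] at hj
    have h1 : ζ ^ j ≠ 1 := hζ.pow_ne_one_of_pos_of_lt hj0 hj
    have h2 : ∀ s : ℕ, ((ζ ^ s • A) ^ j) x = (ζ ^ j) ^ s • (A ^ j) x := by
      intro s
      rw [smul_pow, LinearMap.smul_apply, ← pow_mul, ← pow_mul, mul_comm]
    simp only [h2]
    rw [← Finset.sum_smul, geom_sum_eq h1, ← pow_mul, mul_comm, pow_mul, hζ.pow_eq_one, one_pow,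
      sub_self, zero_div, zero_smul]
  · intro h0
    exact absurd (Finset.mem_range.mpr (NeZero.pos M)) h0

end Average

/-! ### Linearity of homomorphisms over the base. -/

section OverBaseHom

variable {k R V W : Type*} [CommRing k] [CommRing R] [Algebra k R] [HasseSchmidt k R]
  [AddCommGroup V] [Module k V] [VertexAlgebra k V] [OverBase k R V]
  [AddCommGroup W] [Module k W] [VertexAlgebra k W] [OverBase k R W]

/-- Scalar multiplication is expressed through a product and the structure map, so an additive map
preserving these is automatically linear. -/
lemma OverBase.nprod_ι_smul_one (c : k) (x : V) :
    nprod (k := k) (-1) (OverBase.ι (k := k) (c • (1 : R))) x = c • x := by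
  rw [map_smul, OverBase.ι_one, map_smul, LinearMap.smul_apply, vac_nprod, if_pos rfl]

/-- Homomorphisms over `R` are `k`-linear. -/
def OverBase.Hom.toLinearMap (φ : OverBase.Hom k R V W) : V →ₗ[k] W where
  toFun := φ.toAddMonoidHom
  map_add' := φ.toAddMonoidHom.map_add
  map_smul' c x := by
    have h := φ.map_nprod (-1) (OverBase.ι (k := k) (c • (1 : R))) x
    rw [φ.map_ι, nprod_ι_smul_one, nprod_ι_smul_one] at h
    exact h

end OverBaseHom

/-! ### Projection onto the twisted loop algebra. -/

section TwistedLoop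

variable {k V : Type*} [Field k] [CharZero k] [AddCommGroup V] [Module k V] [VertexAlgebra k V]
  {M : ℕ} [NeZero M] {ζ : k} {W : Type*} [AddCommGroup W] [Module k W]

/-- No closure under scalars is asked of `p`: a scalar on the Laurent factor is moved to the vector,
which is why the inner induction generalizes `v`. -/
lemma tmul_t_induction {p : V ⊗[k] RootLaurent k M → Prop} (h0 : p 0)
    (hadd : ∀ x y, p x → p y → p (x + y)) (ht : ∀ (v : V) (a : ℤ), p (v ⊗ₜ RootLaurent.t M a))
    (x : V ⊗[k] RootLaurent k M) : p x := by
  induction x using TensorProduct.induction_on with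
  | zero => exact h0
  | add x y hx hy => exact hadd x y hx hy
  | tmul v s =>
    have hs := (RootLaurent.basis k M).mem_span s
    induction hs using Submodule.span_induction generalizing v with
    | mem s hs =>
      obtain ⟨a, rfl⟩ := hs
      rw [RootLaurent.basis_apply]
      exact ht v a
    | zero => rwa [TensorProduct.tmul_zero]
    | add s s' _ _ h h' => rw [TensorProduct.tmul_add]; exact hadd _ _ (h v) (h' v)
    | smul c s _ h => rw [← TensorProduct.smul_tmul]; exact h (c • v)

lemma end_pow_eq_one {g : Aut k V} (hg : g.toLinearEquiv ^ M = 1) :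
    g.toLinearEquiv.toLinearMap ^ M = (1 : Module.End k V) := by
  have := congrArg (LinearEquiv.automorphismGroup.toLinearMapMonoidHom (R := k) (M := V)) hg
  rwa [map_pow, map_one] at this

lemma smul_end_pow_eq_one {g : Aut k V} (hζ : IsPrimitiveRoot ζ M)
    (hg : g.toLinearEquiv ^ M = 1) (a : ℤ) :
    (ζ ^ a • g.toLinearEquiv.toLinearMap) ^ M = (1 : Module.End k V) := by
  rw [smul_pow, end_pow_eq_one hg, ← zpow_natCast, ← zpow_mul, mul_comm, zpow_mul, zpow_natCast,
    hζ.pow_eq_one, one_zpow, one_smul]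

/-- On the slice V ⊗ t^{a/M} the operator g ⊗ γ is ζ^a g, so its powers and averages can be computed
in V. -/
lemma loopAut_tmul_t (g : Aut k V) (hζ : IsPrimitiveRoot ζ M) (a : ℤ) (v : V) :
    loopAut g hζ (v ⊗ₜ RootLaurent.t M a) =
      (ζ ^ a • g.toLinearEquiv.toLinearMap) v ⊗ₜ[k] RootLaurent.t M a := by
  rw [loopAut_tmul, RootLaurent.galois, RootLaurent.liftHom_t, TensorProduct.tmul_smul,
    LinearMap.smul_apply, TensorProduct.smul_tmul']
  rfl

lemma loopAut_pow {g : Aut k V} (hζ : IsPrimitiveRoot ζ M) (hg : g.toLinearEquiv ^ M = 1) :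
    (loopAut g hζ : Module.End k (V ⊗[k] RootLaurent k M)) ^ M = 1 := by
  refine LinearMap.ext fun x => ?_
  induction x using tmul_t_induction with
  | h0 => simp
  | hadd x y hx hy => rw [map_add, map_add, hx, hy]
  | ht v a =>
    have := apply_pow_of_comm (A' := loopAut g hζ)
      ((TensorProduct.mk k V (RootLaurent k M)).flip (RootLaurent.t M a))
      (fun v => (loopAut_tmul_t g hζ a v).symm) M v
    rw [smul_end_pow_eq_one hζ hg] at this
    exact this.symm

lemma average_loopAut_mem {g : Aut k V} (hζ : IsPrimitiveRoot ζ M)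
    (hg : g.toLinearEquiv ^ M = 1) (x : V ⊗[k] RootLaurent k M) :
    average M (loopAut g hζ) x ∈ Loop g hζ :=
  apply_average (loopAut_pow hζ hg) x

/-- The projection of `V ⊗ k[t^{±1/M}]` onto `L(V, g)`. -/
noncomputable def loopProj (g : Aut k V) (hζ : IsPrimitiveRoot ζ M)
    (hg : g.toLinearEquiv ^ M = 1) : V ⊗[k] RootLaurent k M →ₗ[k] Loop g hζ :=
  (average M (loopAut g hζ)).codRestrict (Loop g hζ) (average_loopAut_mem hζ hg)

lemma loopProj_coe {g : Aut k V} (hζ : IsPrimitiveRoot ζ M)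
    (hg : g.toLinearEquiv ^ M = 1) (x : Loop g hζ) : loopProj g hζ hg x = x :=
  Subtype.ext (average_of_apply_eq x.2)

/-- Since g ⊗ γ preserves products and fixes x, the operator y ↦ x_n y commutes with it, hence with
averaging. This allows an arbitrary second argument in the Jacobi identity. -/
lemma loopProj_nprod {g : Aut k V} (hζ : IsPrimitiveRoot ζ M) (hg : g.toLinearEquiv ^ M = 1)
    (n : ℤ) (x : Loop g hζ) (y : V ⊗[k] RootLaurent k M) :
    loopProj g hζ hg (nprod (k := k) n (x : V ⊗[k] RootLaurent k M) y) =
      nprod (k := k) n x (loopProj g hζ hg y) := by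
  refine Subtype.ext (Eq.symm ?_)
  refine apply_average_of_comm (nprod (k := k) n (x : V ⊗[k] RootLaurent k M)) (fun z => ?_) M y
  rw [loopAut_nprod, (mem_Loop g hζ _).mp x.2]

/-- The average is fixed by ζ^a g, and the fixed vectors of ζ^a g are the eigenvectors of g for
ζ^{-a}. -/
lemma average_mem_eigen {g : Aut k V} (hζ : IsPrimitiveRoot ζ M)
    (hg : g.toLinearEquiv ^ M = 1) (a : ℤ) (v : V) :
    average M (ζ ^ a • g.toLinearEquiv.toLinearMap) v ∈ eigen g ζ a := by
  have h := apply_average (smul_end_pow_eq_one hζ hg a) v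
  rw [LinearMap.smul_apply] at h
  refine Module.End.mem_eigenspace_iff.mpr ?_
  conv_rhs => rw [← h]
  rw [smul_smul, zpow_neg, inv_mul_cancel₀ (zpow_ne_zero _ (hζ.ne_zero (NeZero.ne M))), one_smul]

/-- `L(V, g)` is spanned by the elements `v_{(n)}`. -/
lemma Loop_induction {g : Aut k V} (hζ : IsPrimitiveRoot ζ M) (hg : g.toLinearEquiv ^ M = 1)
    {p : V ⊗[k] RootLaurent k M → Prop} (h0 : p 0) (hadd : ∀ x y, p x → p y → p (x + y))
    (ht : ∀ (a : ℤ), ∀ v ∈ eigen g ζ a, p (v ⊗ₜ RootLaurent.t M a)) (x : Loop g hζ) : p x := by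
  -- An element of the loop algebra is its own average, and the average of v ⊗ t^{a/M} is v' ⊗
  -- t^{a/M} with v' in V^{g,a}.
  rw [← loopProj_coe hζ hg x]
  generalize (x : V ⊗[k] RootLaurent k M) = y
  change p (average M (loopAut g hζ) y)
  induction y using tmul_t_induction with
  | h0 => rwa [map_zero]
  | hadd x y hx hy => rw [map_add]; exact hadd _ _ hx hy
  | ht v a =>
    have := apply_average_of_comm (A' := loopAut g hζ)
      ((TensorProduct.mk k V (RootLaurent k M)).flip (RootLaurent.t M a))
      (fun v => (loopAut_tmul_t g hζ a v).symm) M v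
    simp only [LinearMap.flip_apply, TensorProduct.mk_apply] at this
    rw [← this]
    exact ht a _ (average_mem_eigen hζ hg a v)

/-! ### Multiplication by integral powers of t. -/

variable (k V) in
/-- Multiplication by `t ^ q` on `V ⊗ k[t^{±1/M}]`. -/
noncomputable def mulT (M : ℕ) (q : ℤ) : Module.End k (V ⊗[k] RootLaurent k M) :=
  LinearMap.lTensor V (LinearMap.mul k (RootLaurent k M) (RootLaurent.t M (M * q)))

lemma mulT_tmul_t (q : ℤ) (v : V) (a : ℤ) :
    mulT k V M q (v ⊗ₜ RootLaurent.t M a) = v ⊗ₜ RootLaurent.t M (a + q * M) := by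
  rw [mulT, LinearMap.lTensor_tmul, LinearMap.mul_apply', ← RootLaurent.t_add]
  congr 2
  ring

/-- Because Y(1, z) = id, only the term j = 0 of the product survives. Multiplication by t^q thus
belongs to the structure that φ preserves. -/
lemma nprod_ι_t (g : Aut k V) (hζ : IsPrimitiveRoot ζ M) (q : ℤ) (x : Loop g hζ) :
    ((nprod (k := k) (-1) (OverBase.ι (k := k) (RootLaurent.t 1 q : RootLaurent k 1)) x :
      Loop g hζ) : V ⊗[k] RootLaurent k M) = mulT k V M q x := by
  rw [coe_nprod]
  change tensorProd k V _ (-1) ((vac (k := k) : V) ⊗ₜ[k] RootLaurent.incl M (RootLaurent.t 1 q)) _ = _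
  rw [RootLaurent.incl, RootLaurent.liftHom_t]
  generalize (x : V ⊗[k] RootLaurent k M) = y
  induction y using TensorProduct.induction_on with
  | zero => simp
  | add y z hy hz => rw [map_add, map_add, hy, hz]
  | tmul v s =>
    rw [tensorProd_tmul_range _ _ _ _ _ 1]
    · simp [vac_nprod, HasseSchmidt.D_zero, mulT]
    · intro j hj
      rw [vac_nprod, if_neg (by omega)]

/-- `mulT` restricted to `L(V, g)`. -/
noncomputable def loopMulT (g : Aut k V) (hζ : IsPrimitiveRoot ζ M) (q : ℤ) :
    Module.End k (Loop g hζ) :=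
  nprod (k := k) (-1) (OverBase.ι (k := k) (RootLaurent.t 1 q : RootLaurent k 1))

lemma coe_loopMulT (g : Aut k V) (hζ : IsPrimitiveRoot ζ M) (q : ℤ) (x : Loop g hζ) :
    (loopMulT g hζ q x : V ⊗[k] RootLaurent k M) = mulT k V M q x :=
  nprod_ι_t g hζ q x

lemma OverBase.Hom.map_loopMulT {g h : Aut k V} {hζ : IsPrimitiveRoot ζ M}
    (φ : OverBase.Hom k (RootLaurent k 1) (Loop g hζ) (Loop h hζ)) (q : ℤ) (x : Loop g hζ) :
    φ.toLinearMap (loopMulT g hζ q x) = loopMulT h hζ q (φ.toLinearMap x) := by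
  refine (φ.map_nprod _ _ _).trans ?_
  rw [φ.map_ι]
  rfl

/-- The automorphism γ fixes integral powers of t, as ζ^{qM} = 1. -/
lemma loopProj_mulT {g : Aut k V} (hζ : IsPrimitiveRoot ζ M) (hg : g.toLinearEquiv ^ M = 1)
    (q : ℤ) (x : V ⊗[k] RootLaurent k M) :
    loopProj g hζ hg (mulT k V M q x) = loopMulT g hζ q (loopProj g hζ hg x) := by
  refine Subtype.ext (Eq.symm ((coe_loopMulT g hζ q _).trans ?_))
  refine apply_average_of_comm (mulT k V M q) (fun z => ?_) M x
  induction z using tmul_t_induction with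
  | h0 => simp
  | hadd x y hx hy => simp only [map_add, hx, hy]
  | ht v a =>
    rw [loopAut_tmul_t, mulT_tmul_t, mulT_tmul_t, loopAut_tmul_t, zpow_add₀
      (hζ.ne_zero (NeZero.ne M)), mul_comm q, zpow_mul, zpow_natCast, hζ.pow_eq_one, one_zpow,
      mul_one]

/-! ### Twisted module axioms in terms of the loop algebra. -/

/-- The linear map `V ⊗ k[t^{±1/M}] → End W` with `v ⊗ t ^ n ↦ v_n`. -/
noncomputable def tensorMode (M : ℕ) (Y : ℤ → V →ₗ[k] Module.End k W) :
    V ⊗[k] RootLaurent k M →ₗ[k] Module.End k W :=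
  TensorProduct.lift ((RootLaurent.basis k M).constr k Y).flip

lemma tensorMode_tmul_t (Y : ℤ → V →ₗ[k] Module.End k W) (v : V) (a : ℤ) :
    tensorMode M Y (v ⊗ₜ RootLaurent.t M a) = Y a v := by
  simp only [tensorMode, TensorProduct.lift.tmul, LinearMap.flip_apply, ← RootLaurent.basis_apply,
    Module.Basis.constr_basis]

lemma modeMap_apply (h : Aut k V) (hζ : IsPrimitiveRoot ζ M) (Y : ℤ → V →ₗ[k] Module.End k W)
    (x : Loop h hζ) : modeMap h hζ Y x = tensorMode M Y x := rfl

/-- Truncation in a form that refers to no eigenvectors or exponents, only to powers of t, so that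
it can be applied to elements φ(x) of unknown shape. -/
lemma tensorMode_mulT_eq_zero {h : Aut k V} {Y : ℤ → V →ₗ[k] Module.End k W}
    (hY : IsWeakTwistedModule h M ζ Y) (x : V ⊗[k] RootLaurent k M) (w : W) :
    ∃ N : ℕ, ∀ q : ℤ, (N : ℤ) ≤ q → tensorMode M Y (mulT k V M q x) w = 0 := by
  induction x using tmul_t_induction with
  | h0 => exact ⟨0, fun q _ => by simp⟩
  | hadd x y hx hy =>
    obtain ⟨N₁, h₁⟩ := hx
    obtain ⟨N₂, h₂⟩ := hy
    refine ⟨N₁ + N₂, fun q hq => ?_⟩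
    rw [map_add, map_add, LinearMap.add_apply, h₁ q (by omega), h₂ q (by omega), add_zero]
  | ht v a =>
    obtain ⟨N, hN⟩ := hY.regular v w
    -- The aim is a + qM ≥ N. Truncating the bound at 0 ensures q ≥ 0, so that qM ≥ q ≥ N - a.
    refine ⟨(N - a).toNat, fun q hq => ?_⟩
    rw [mulT_tmul_t, tensorMode_tmul_t]
    refine hN _ ?_
    have hM : (1 : ℤ) ≤ M := by exact_mod_cast NeZero.pos M
    have hq0 : 0 ≤ q := by omega
    have : q ≤ q * M := le_mul_of_one_le_right hq0 hM
    omega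

/-- The coefficients binom(a/M, i) of the twisted Jacobi identity arise here, from the divided
derivatives of t^{a/M}. -/
lemma nprod_tmul_t (l : ℤ) (u v : V) (a b : ℤ) (K : ℕ)
    (hK : ∀ i : ℕ, K ≤ i → nprod (k := k) (l + i) u v = 0) :
    nprod (k := k) l (u ⊗ₜ[k] RootLaurent.t M a) (v ⊗ₜ[k] RootLaurent.t M b) =
      ∑ i ∈ Finset.range K, Ring.choose ((a : k) / (M : k)) i •
        (nprod (k := k) (l + i) u v ⊗ₜ[k] (RootLaurent.t M (a + b - i * M) : RootLaurent k M)) := by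
  refine (tensorProd_tmul_range _ _ _ _ _ K hK).trans (Finset.sum_congr rfl fun i _ => ?_)
  rw [RootLaurent.D_t, smul_mul_assoc, TensorProduct.tmul_smul, ← RootLaurent.t_add]
  congr 3
  ring

/-- The twisted Jacobi identity as an identity over the loop algebra: both sides are bilinear in
`x` and `y`, and only multiplication by powers of `t` and the products of the loop algebra occur. -/
lemma tensorMode_jacobi {h : Aut k V} (hζ : IsPrimitiveRoot ζ M) (hh : h.toLinearEquiv ^ M = 1)
    {Y : ℤ → V →ₗ[k] Module.End k W}
    (hY : IsWeakTwistedModule h M ζ Y) (l : ℤ) (x : Loop h hζ) (y : V ⊗[k] RootLaurent k M)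
    (w : W) : ∃ N : ℕ, ∀ K, N ≤ K →
      tensorMode M Y (nprod (k := k) l (x : V ⊗[k] RootLaurent k M) y) w =
      ∑ i ∈ Finset.range K, ((-1) ^ i * Ring.choose l i) •
        (tensorMode M Y (mulT k V M (l - i) x) (tensorMode M Y (mulT k V M i y) w) -
          (l.negOnePow : ℤ) •
            tensorMode M Y (mulT k V M (l - i) y) (tensorMode M Y (mulT k V M i x) w)) := by
  -- Asking for the identity at every large truncation K makes it additive in x and in y: two bounds
  -- are merged by adding them.
  refine Loop_induction hζ hh (p := fun x => ∃ N : ℕ, ∀ K, N ≤ K →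
      tensorMode M Y (nprod (k := k) l x y) w =
      ∑ i ∈ Finset.range K, ((-1) ^ i * Ring.choose l i) •
        (tensorMode M Y (mulT k V M (l - i) x) (tensorMode M Y (mulT k V M i y) w) -
          (l.negOnePow : ℤ) •
            tensorMode M Y (mulT k V M (l - i) y) (tensorMode M Y (mulT k V M i x) w)))
    ⟨0, fun K _ => by simp⟩ ?_ ?_ x
  · rintro x₁ x₂ ⟨N₁, h₁⟩ ⟨N₂, h₂⟩
    refine ⟨N₁ + N₂, fun K hK => ?_⟩
    simp only [map_add, LinearMap.add_apply]
    rw [h₁ K (by omega), h₂ K (by omega), ← Finset.sum_add_distrib]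
    refine Finset.sum_congr rfl fun i _ => ?_
    rw [← smul_add]; congr 1; rw [smul_add]; abel
  intro a u hu
  induction y using tmul_t_induction with
  | h0 => exact ⟨0, fun K _ => by simp⟩
  | hadd y₁ y₂ hy₁ hy₂ =>
    obtain ⟨N₁, h₁⟩ := hy₁
    obtain ⟨N₂, h₂⟩ := hy₂
    refine ⟨N₁ + N₂, fun K hK => ?_⟩
    simp only [map_add, LinearMap.add_apply]
    rw [h₁ K (by omega), h₂ K (by omega), ← Finset.sum_add_distrib]
    refine Finset.sum_congr rfl fun i _ => ?_
    rw [← smul_add]; congr 1; rw [smul_add]; abel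
  | ht v b =>
    obtain ⟨A, hA⟩ := exists_bound_shift (k := k) u v l
    obtain ⟨N₁, h₁⟩ := tensorMode_mulT_eq_zero hY (u ⊗ₜ RootLaurent.t M a) w
    obtain ⟨N₂, h₂⟩ := tensorMode_mulT_eq_zero hY (v ⊗ₜ RootLaurent.t M b) w
    simp only [mulT_tmul_t, tensorMode_tmul_t] at h₁ h₂
    refine ⟨A + N₁ + N₂, fun K hK => ?_⟩
    -- The exponent of t attached to u matches its eigenspace, as the twisted Jacobi identity
    -- requires; v and b are unrelated.
    have := hY.jacobi a b l u hu v w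
    rw [finsum_eq_range _ K, finsum_eq_range _ K] at this
    · simp only [mulT_tmul_t, tensorMode_tmul_t]
      rw [← this, nprod_tmul_t l u v a b K (fun i hi => hA i (by omega)), map_sum,
        LinearMap.sum_apply]
      exact Finset.sum_congr rfl fun i _ => by
        rw [map_smul, LinearMap.smul_apply, tensorMode_tmul_t]
    · intro i hi
      rw [h₁ i (by omega), h₂ i (by omega)]
      simp
    · intro i hi
      rw [hA i (by omega)]
      simp

/-! ### The pullback and its axioms. -/

/-- The modes of the pullback `φ^* Y`, extended to `V ⊗ k[t^{±1/M}]` by projecting to `L(V, g)`. -/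
noncomputable def pullbackMode {g h : Aut k V} {hζ : IsPrimitiveRoot ζ M}
    (hg : g.toLinearEquiv ^ M = 1)
    (φ : OverBase.Hom k (RootLaurent k 1) (Loop g hζ) (Loop h hζ))
    (Y : ℤ → V →ₗ[k] Module.End k W) : V ⊗[k] RootLaurent k M →ₗ[k] Module.End k W :=
  modeMap h hζ Y ∘ₗ φ.toLinearMap ∘ₗ loopProj g hζ hg

/-- The pullback `φ^* Y`. -/
noncomputable def pullback {g h : Aut k V} {hζ : IsPrimitiveRoot ζ M}
    (hg : g.toLinearEquiv ^ M = 1)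
    (φ : OverBase.Hom k (RootLaurent k 1) (Loop g hζ) (Loop h hζ))
    (Y : ℤ → V →ₗ[k] Module.End k W) (a : ℤ) : V →ₗ[k] Module.End k W :=
  pullbackMode hg φ Y ∘ₗ (TensorProduct.mk k V (RootLaurent k M)).flip (RootLaurent.t M a)

variable {g h : Aut k V} {hζ : IsPrimitiveRoot ζ M} (hg : g.toLinearEquiv ^ M = 1)
  (φ : OverBase.Hom k (RootLaurent k 1) (Loop g hζ) (Loop h hζ))
  {Y : ℤ → V →ₗ[k] Module.End k W}

lemma pullback_apply (a : ℤ) (v : V) :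
    pullback hg φ Y a v = pullbackMode hg φ Y (v ⊗ₜ RootLaurent.t M a) := rfl

/-- Powers of t pass through the projection and through φ, which turns modes of the pullback into
modes of the given h-twisted module. -/
lemma pullbackMode_mulT (q : ℤ) (x : V ⊗[k] RootLaurent k M) :
    pullbackMode hg φ Y (mulT k V M q x) =
      tensorMode M Y (mulT k V M q (φ.toLinearMap (loopProj g hζ hg x))) := by
  simp only [pullbackMode, LinearMap.comp_apply]
  rw [loopProj_mulT, φ.map_loopMulT, modeMap_apply, coe_loopMulT]

lemma pullbackMode_nprod (l : ℤ) (x : Loop g hζ) (y : V ⊗[k] RootLaurent k M) :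
    pullbackMode hg φ Y (nprod (k := k) l (x : V ⊗[k] RootLaurent k M) y) =
      tensorMode M Y (nprod (k := k) l (φ.toLinearMap x : V ⊗[k] RootLaurent k M)
        (φ.toLinearMap (loopProj g hζ hg y))) := by
  simp only [pullbackMode, LinearMap.comp_apply]
  rw [loopProj_nprod, modeMap_apply, ← coe_nprod]
  congr 2
  exact φ.map_nprod l x _

/-- The projection fixes v_{(n)}. If the exponent a does not match r, then v ⊗ t^{a/M} is an
eigenvector of g ⊗ γ with eigenvalue ζ^{a-r} ≠ 1 and averages to zero. -/
lemma isPullback_pullback : IsPullback φ Y (pullback hg φ Y) where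
  mode a v := by
    rw [pullback_apply]
    have : (v : V) ⊗ₜ[k] RootLaurent.t M a = (loopElt g hζ a v : V ⊗[k] RootLaurent k M) := rfl
    rw [this, pullbackMode, LinearMap.comp_apply, LinearMap.comp_apply, loopProj_coe]
    rfl
  support r a v hv har := by
    have hv' : g.toLinearEquiv.toLinearMap v = ζ ^ (-r) • v := Module.End.mem_eigenspace_iff.mp hv
    have h0 : loopProj g hζ hg (v ⊗ₜ RootLaurent.t M a) = 0 := by
      refine Subtype.ext (average_eq_zero (c := ζ ^ (a - r)) ?_ ?_ ?_)
      · rw [loopAut_tmul_t, LinearMap.smul_apply, hv', smul_smul,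
          ← zpow_add₀ (hζ.ne_zero (NeZero.ne M)), ← sub_eq_add_neg, TensorProduct.smul_tmul']
      · rw [← zpow_natCast, ← zpow_mul, mul_comm, zpow_mul, zpow_natCast, hζ.pow_eq_one, one_zpow]
      · rw [Ne, hζ.zpow_eq_one_iff_dvd]
        exact fun hd => har (Int.modEq_iff_dvd.mpr hd).symm
    rw [pullback_apply, pullbackMode, LinearMap.comp_apply, LinearMap.comp_apply, h0, map_zero,
      map_zero]

lemma IsPullback.unique (hg : g.toLinearEquiv ^ M = 1)
    {φ : OverBase.Hom k (RootLaurent k 1) (Loop g hζ) (Loop h hζ)}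
    {Y₁ Y₂ : ℤ → V →ₗ[k] Module.End k W} (h₁ : IsPullback φ Y Y₁) (h₂ : IsPullback φ Y Y₂) :
    Y₁ = Y₂ := by
  funext a
  ext1 v
  -- Decompose v into its components in the V^{g,s}. On each of them one of the two defining
  -- conditions determines the coefficient.
  rw [← sum_average_smul hζ g.toLinearEquiv.toLinearMap v, map_sum, map_sum]
  refine Finset.sum_congr rfl fun s _ => ?_
  have hs := average_mem_eigen hζ hg s v
  rw [zpow_natCast] at hs
  generalize average M (ζ ^ s • g.toLinearEquiv.toLinearMap) v = u at hs
  by_cases has : a ≡ s [ZMOD M]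
  · have hu : u ∈ eigen g ζ a := by
      have : ζ ^ (-a) = ζ ^ (-(s : ℤ)) := by
        rw [← div_eq_one_iff_eq (zpow_ne_zero _ (hζ.ne_zero (NeZero.ne M))),
          ← zpow_sub₀ (hζ.ne_zero (NeZero.ne M)), hζ.zpow_eq_one_iff_dvd, neg_sub_neg]
        exact has.dvd
      rwa [eigen, this]
    rw [h₁.mode a ⟨u, hu⟩, h₂.mode a ⟨u, hu⟩]
  · rw [h₁.support s a u hs has, h₂.support s a u hs has]

lemma pullbackMode_mulT_eq_zero (hY : IsWeakTwistedModule h M ζ Y)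
    (x : V ⊗[k] RootLaurent k M) (w : W) :
    ∃ N : ℕ, ∀ q : ℤ, (N : ℤ) ≤ q → pullbackMode hg φ Y (mulT k V M q x) w = 0 := by
  simp only [pullbackMode_mulT]
  exact tensorMode_mulT_eq_zero hY _ w

lemma pullback_regular (hY : IsWeakTwistedModule h M ζ Y) (v : V) (w : W) :
    ∃ N : ℤ, ∀ a : ℤ, N ≤ a → pullback hg φ Y a v w = 0 := by
  -- Write a = s + qM with 0 ≤ s < M. Each residue s has its own bound on q, and the sum of these M
  -- bounds dominates them all.
  choose N hN using fun s : ℕ => pullbackMode_mulT_eq_zero hg φ hY (v ⊗ₜ RootLaurent.t M s) w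
  have hM : (0 : ℤ) < M := by exact_mod_cast NeZero.pos M
  refine ⟨(∑ s ∈ Finset.range M, N s : ℕ) * M, fun a ha => ?_⟩
  have hr : 0 ≤ a % M := Int.emod_nonneg a hM.ne'
  have hr' : a % M < M := Int.emod_lt_of_pos a hM
  have hs : (a % M).toNat ∈ Finset.range M := Finset.mem_range.mpr (by omega)
  have h1 := Finset.single_le_sum (f := N) (fun _ _ => Nat.zero_le _) hs
  have h2 : ((∑ s ∈ Finset.range M, N s : ℕ) : ℤ) ≤ a / M := (Int.le_ediv_iff_mul_le hM).mpr ha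
  have h3 := hN (a % M).toNat (a / M) (by omega)
  rw [mulT_tmul_t, Int.toNat_of_nonneg hr, mul_comm, Int.emod_add_mul_ediv] at h3
  exact h3

/-- For a = Mq the element 1 ⊗ t^q is the image of t^q under the structure map, which φ preserves.
Otherwise the support condition applies, as the vacuum lies in V^{g,0}. -/
lemma pullback_vacuum (hY : IsWeakTwistedModule h M ζ Y) (a : ℤ) :
    pullback hg φ Y a (vac (k := k)) = if a = -M then 1 else 0 := by
  by_cases ha : (M : ℤ) ∣ a
  · obtain ⟨q, rfl⟩ := ha
    have e : ∀ g : Aut k V, ((OverBase.ι (k := k) (RootLaurent.t 1 q : RootLaurent k 1) :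
        Loop g hζ) : V ⊗[k] RootLaurent k M) = vac (k := k) ⊗ₜ RootLaurent.t M (M * q) := by
      intro g
      change (vac (k := k) : V) ⊗ₜ[k] RootLaurent.incl M (RootLaurent.t 1 q) = _
      rw [RootLaurent.incl, RootLaurent.liftHom_t]
    rw [pullback_apply, ← e g, pullbackMode, LinearMap.comp_apply, LinearMap.comp_apply,
      loopProj_coe]
    have h1 : φ.toLinearMap (OverBase.ι (k := k) (RootLaurent.t 1 q : RootLaurent k 1)) =
      OverBase.ι (k := k) (RootLaurent.t 1 q : RootLaurent k 1) := φ.map_ι _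
    rw [h1, modeMap_apply, e h, tensorMode_tmul_t, hY.vacuum]
  · have h0 : (vac (k := k) : V) ∈ eigen g ζ 0 := by
      refine Module.End.mem_eigenspace_iff.mpr ?_
      rw [neg_zero, zpow_zero, one_smul]
      exact g.map_vac
    rw [(isPullback_pullback hg φ).support 0 a _ h0
      (fun hc => ha (Int.modEq_zero_iff_dvd.mp hc)), if_neg]
    rintro rfl
    exact ha (dvd_neg.mpr dvd_rfl)

/-- This is `tensorMode_jacobi` evaluated at φ(x) and φ of the projection of v ⊗ t^{b/M}. The
hypothesis on u serves to place x = u ⊗ t^{a/M} in L(V,g). -/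
lemma pullback_jacobi (hh : h.toLinearEquiv ^ M = 1) (hY : IsWeakTwistedModule h M ζ Y)
    (a b l : ℤ) (u : V) (hu : u ∈ eigen g ζ a) (v : V) (w : W) :
    ∑ᶠ i : ℕ, Ring.choose ((a : k) / (M : k)) i •
      pullback hg φ Y (a + b - i * M) (nprod (k := k) (l + i) u v) w =
    ∑ᶠ i : ℕ, ((-1) ^ i * Ring.choose l i) •
      (pullback hg φ Y (a + (l - i) * M) u (pullback hg φ Y (b + i * M) v w) -
        (l.negOnePow : ℤ) •
          pullback hg φ Y (b + (l - i) * M) v (pullback hg φ Y (a + i * M) u w)) := by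
  set x : Loop g hζ := loopElt g hζ a ⟨u, hu⟩
  have hxu : u ⊗ₜ[k] RootLaurent.t M a = (x : V ⊗[k] RootLaurent k M) := rfl
  obtain ⟨A, hA⟩ := exists_bound_shift (k := k) u v l
  obtain ⟨N₁, h₁⟩ := pullbackMode_mulT_eq_zero hg φ hY (u ⊗ₜ RootLaurent.t M a) w
  obtain ⟨N₂, h₂⟩ := pullbackMode_mulT_eq_zero hg φ hY (v ⊗ₜ RootLaurent.t M b) w
  obtain ⟨N₃, h₃⟩ := tensorMode_jacobi hζ hh hY l (φ.toLinearMap x)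
    (φ.toLinearMap (loopProj g hζ hg (v ⊗ₜ RootLaurent.t M b))) w
  -- This truncation lies beyond every nonzero term of both sums, so the finite sums can be
  -- exchanged for the unrestricted ones at the end.
  have h₄ := h₃ (A + N₁ + N₂ + N₃) (by omega)
  rw [← pullbackMode_nprod, ← hxu, nprod_tmul_t l u v a b (A + N₁ + N₂ + N₃)
    (fun i hi => hA i (by omega)), map_sum, LinearMap.sum_apply] at h₄
  -- Inserting the redundant projection brings x to the same form as the second argument, so
  -- `pullbackMode_mulT` can be read backwards on both.
  have hpx : φ.toLinearMap x = φ.toLinearMap (loopProj g hζ hg (u ⊗ₜ RootLaurent.t M a)) := by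
    rw [hxu, loopProj_coe]
  rw [hpx] at h₄
  simp only [← pullbackMode_mulT, mulT_tmul_t, map_smul, LinearMap.smul_apply,
    ← pullback_apply] at h₄
  simp only [mulT_tmul_t, ← pullback_apply] at h₁ h₂
  rw [finsum_eq_range _ (A + N₁ + N₂ + N₃), finsum_eq_range _ (A + N₁ + N₂ + N₃)]
  · exact h₄
  · intro i hi
    rw [h₁ i (by omega), h₂ i (by omega)]
    simp
  · intro i hi
    rw [hA i (by omega)]
    simp

lemma isWeakTwistedModule_pullback (hh : h.toLinearEquiv ^ M = 1)
    (hY : IsWeakTwistedModule h M ζ Y) : IsWeakTwistedModule g M ζ (pullback hg φ Y) where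
  support := (isPullback_pullback hg φ).support
  regular := pullback_regular hg φ hY
  vacuum := pullback_vacuum hg φ hY
  jacobi := pullback_jacobi hg φ hh hY

end TwistedLoop

end VertexAlgebra

theorem mainTheorem7 {k : Type*} [Field k] [CharZero k]
    {V : Type*} [AddCommGroup V] [Module k V] [VertexAlgebra k V]
    {M : ℕ} [NeZero M] {ζ : k} (hζ : IsPrimitiveRoot ζ M)
    (g h : VertexAlgebra.Aut k V)
    (hg : g.toLinearEquiv ^ M = 1) (hh : h.toLinearEquiv ^ M = 1)
    (φ : VertexAlgebra.OverBase.Hom k (RootLaurent k 1)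
      (VertexAlgebra.Loop g hζ) (VertexAlgebra.Loop h hζ))
    {W : Type*} [AddCommGroup W] [Module k W]
    (Y : ℤ → V →ₗ[k] Module.End k W) (hY : VertexAlgebra.IsWeakTwistedModule h M ζ Y) :
    ∃ Y' : ℤ → V →ₗ[k] Module.End k W,
      VertexAlgebra.IsPullback φ Y Y' ∧
      (∀ Y'' : ℤ → V →ₗ[k] Module.End k W, VertexAlgebra.IsPullback φ Y Y'' → Y'' = Y') ∧
      VertexAlgebra.IsWeakTwistedModule g M ζ Y' :=
  ⟨VertexAlgebra.pullback hg φ Y, VertexAlgebra.isPullback_pullback hg φ,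
    fun _ h'' => h''.unique hg (VertexAlgebra.isPullback_pullback hg φ),
    VertexAlgebra.isWeakTwistedModule_pullback hg φ hh hY⟩
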